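/- **Setting.** For each $n\ge 1$ let $\nu_n$ be a probability measure on $\mathbb{R}^n$ that is invariant under all linear isometries and satisfies $\nu_n(\{0\})=0$. Assume that there are a deterministic sequence $(a_n)_{n\ge1}$ of nonzero reals and constants $d_1,d_2,\alpha>0$, $\rho_0\in(0,1)$ such that for every $n\ge 1$ and $\rho\in(0,\rho_0)$ $$\nu_n\left(\left\{x:\left|\frac{\|x\|^2}{a_n}-1\right|\ge\rho\right\}\right)\le d_1e^{-nd_2\rho^\alpha}.$$ Let $b_1^{(n)},\dots,b_{n-g}^{(n)}$ be independent random vectors of $\mathbb{R}^n$ with common law $\nu_n$ (a random basis of codimension $g$), and let $\widehat b_1^{(n)},\dots,\widehat b_{n-g}^{(n)}$ be their (unnormalized) Gram–Schmidt orthogonalization. For $g+2\le n$ put $$r_j^{(n)}=\frac{\|\widehat b_{n-j+1}^{(n)}\|^2}{\|\widehat b_{n-j}^{(n)}\|^2}\quad(g+1\le j\le n-1),\qquad \mathcal M_n^g=\min_{g+1\le j\le n-1}r_j^{(n)},\qquad \mathcal I_n^g=\min\{j\in\{g+1,\dots,n-1\}: r_j^{(n)}=\mathcal M_n^g\}.$$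 Let $(\eta_i)_{i\ge1}$ be independent random variables, $\eta_i$ having the gamma distribution with shape parameter $i/2$ and scale $1$, and put $\mathcal R_j=\eta_j/\eta_{j+1}$ for $j\ge1$ and $\mathcal M^k=\inf\{\mathcal R_j: j\ge k+1\}$ for integers $k\ge0$. **Theorem.** (i) For each fixed integer $k\ge0$, $\mathcal M_n^k$ converges in distribution to $\mathcal M^k$ as $n\to\infty$. (ii) Let $g:\mathbb N\to\mathbb N$ satisfy $g(n)\le n-2$ for all sufficiently large $n$ and $g(n)\to\infty$. Then $\mathcal M_n^{g(n)}\to1$ in probability as $n\to\infty$. (iii) For each fixed integer $k\ge0$, there is almost surely a unique index $\mathcal I^k\ge k+1$ such that $\mathcal R_{\mathcal I^k}=\mathcal M^k$, and $\mathcal I_n^k$ converges in distribution to $\mathcal I^k$ as $n\to\infty$. -/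

import Mathlib

open MeasureTheory ProbabilityTheory Filter
open scoped Topology

namespace RandomBasis

/-- A simple spherical model in `ℝⁿ`: a probability law invariant under all linear isometries,
without an atom at the origin. -/
structure IsSimpleSpherical {n : ℕ} (ν : Measure (EuclideanSpace ℝ (Fin n))) : Prop where
  isProbabilityMeasure : IsProbabilityMeasure ν
  map_isometry : ∀ U : EuclideanSpace ℝ (Fin n) ≃ₗᵢ[ℝ] EuclideanSpace ℝ (Fin n), ν.map U = ν
  zero : ν {0} = 0

/-- A spherical model: a simple spherical model in every dimension `n ≥ 1`. -/
def IsSpherical (ν : ∀ n : ℕ, Measure (EuclideanSpace ℝ (Fin n))) : Prop :=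
  ∀ n, 1 ≤ n → IsSimpleSpherical (ν n)

/-- Concentration of the squared radius: there are a deterministic sequence `a` and constants
`d₁, d₂, α > 0`, `ρ₀ ∈ (0, 1)` such that
`νₙ (| ‖x‖² / aₙ - 1 | ≥ ρ) ≤ d₁ exp (- n d₂ ρ ^ α)` for all `n ≥ 1` and `ρ ∈ (0, ρ₀)`. -/
def RadialConcentration (ν : ∀ n : ℕ, Measure (EuclideanSpace ℝ (Fin n))) : Prop :=
  ∃ (a : ℕ → ℝ) (d₁ d₂ α ρ₀ : ℝ),
    (∀ n, 1 ≤ n → a n ≠ 0) ∧ 0 < d₁ ∧ 0 < d₂ ∧ 0 < α ∧ 0 < ρ₀ ∧ ρ₀ < 1 ∧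
    ∀ n : ℕ, 1 ≤ n → ∀ ρ : ℝ, 0 < ρ → ρ < ρ₀ →
      (ν n).real {x | ρ ≤ |‖x‖ ^ 2 / a n - 1|} ≤ d₁ * Real.exp (-((n : ℝ) * d₂ * ρ ^ α))

/-- `b` is a system of `p` independent random vectors of `ℝⁿ` with common law `ν`. -/
structure IsRandomBasis {n p : ℕ} {Ω : Type*} [MeasurableSpace Ω] (P : Measure Ω)
    (ν : Measure (EuclideanSpace ℝ (Fin n)))
    (b : Fin p → Ω → EuclideanSpace ℝ (Fin n)) : Prop where
  hasLaw : ∀ i, HasLaw (b i) ν P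
  indep : iIndepFun b P

/-- The squared norm of the `i`-th Gram-Schmidt vector (unnormalized, `i` counted from `0`). -/
noncomputable def gsNormSq {n p : ℕ} (b : Fin p → EuclideanSpace ℝ (Fin n)) (i : Fin p) : ℝ :=
  ‖InnerProductSpace.gramSchmidt ℝ b i‖ ^ 2

/-- The ratio of the squared norms of two consecutive Gram-Schmidt vectors. Since indices are
counted from `0` here, this is `‖b̂_{i+2}‖² / ‖b̂_{i+1}‖²` when vectors are numbered `1, …, p`. -/
noncomputable def localRatio {n p : ℕ} (b : Fin p → EuclideanSpace ℝ (Fin n))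
    (i : Fin (p - 1)) : ℝ :=
  gsNormSq b ⟨i + 1, by omega⟩ / gsNormSq b ⟨i, by omega⟩

/-- The reduction level: the minimum of the `p - 1` consecutive ratios (meaningful for `p ≥ 2`). -/
noncomputable def reductionLevel {n p : ℕ} (b : Fin p → EuclideanSpace ℝ (Fin n)) : ℝ :=
  ⨅ i : Fin (p - 1), localRatio b i

/-- The index of worst local reduction of a system in `ℝⁿ`: with vectors numbered `1, …, p`, the
smallest `j` such that `‖b̂_{n-j+1}‖² / ‖b̂_{n-j}‖²` equals the reduction level. The ratio
`localRatio b i` has `n - j = i + 1`. -/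
noncomputable def worstIndex {n p : ℕ} (b : Fin p → EuclideanSpace ℝ (Fin n)) : ℕ :=
  sInf {j : ℕ | ∃ i : Fin (p - 1), j + ((i : ℕ) + 1) = n ∧ localRatio b i = reductionLevel b}

/-- `η₁, η₂, …` are independent and `ηᵢ` has the gamma law of shape `i / 2` and scale `1`.
The value `η 0` is not used. -/
structure IsGammaSequence {Ω : Type*} [MeasurableSpace Ω] (P : Measure Ω)
    (η : ℕ → Ω → ℝ) : Prop where
  hasLaw : ∀ i : ℕ, 1 ≤ i → HasLaw (η i) (gammaMeasure ((i : ℝ) / 2) 1) P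
  indep : iIndepFun (fun i : ℕ => η (i + 1)) P

/-- The limit process `R_j = η_j / η_{j+1}`, `j ≥ 1`. -/
noncomputable def limitRatio {Ω : Type*} (η : ℕ → Ω → ℝ) (j : ℕ) (ω : Ω) : ℝ :=
  η j ω / η (j + 1) ω

/-- `M^k = inf {R_j : j ≥ k + 1}`. -/
noncomputable def limitLevel {Ω : Type*} (η : ℕ → Ω → ℝ) (k : ℕ) (ω : Ω) : ℝ :=
  ⨅ j : {j : ℕ // k + 1 ≤ j}, limitRatio η j ω

/-- The index `I^k`: the (smallest, and almost surely the only) `j ≥ k + 1` with `R_j = M^k`. -/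
noncomputable def limitIndex {Ω : Type*} (η : ℕ → Ω → ℝ) (k : ℕ) (ω : Ω) : ℕ :=
  sInf {j : ℕ | k + 1 ≤ j ∧ limitRatio η j ω = limitLevel η k ω}

end RandomBasis

namespace RandomBasis

/-! For standard Gaussian vectors the Gram-Schmidt norms are exactly solvable. Given the first `i`
vectors, the next Gram-Schmidt vector is a Gaussian projected onto a space of dimension `n - i`, so
half its squared norm is gamma of shape `(n - i) / 2`, independently of the past. Read backwards,
the consecutive ratios therefore have the law of a window of the one process `limitRatio η`, on the
same probability space for all `n` (`measurePreserving_gsNormSq_stdGaussian`,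
`map_localRatio_stdGaussian`).

A spherical vector has the law of a Gaussian vector `y` rescaled to the norm of an independent
vector `x` of law `ν n` (`map_transferNorm`). Rescaling only multiplies Gram-Schmidt norms, and both
norms concentrate, so a union bound over at most `n` vectors couples the two families of ratios
uniformly up to a factor close to `1` (`exists_ratio_coupling`).

It remains to see that minimum and minimiser are stable under such perturbations. Almost surely the
limit ratios tend to `1`, are pairwise distinct, and drop below `1` beyond any index; so their
infimum is attained once, with a multiplicative gap to the other values
(`IsGammaSequence.ae_exists_gap`). When the window recedes to infinity, all its ratios are near `1`,
whence (ii). -/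

/-! ### Gamma laws: moments, tails, moment generating functions -/

lemma gammaMeasure_apply_Iic_zero (a : ℝ) : gammaMeasure a 1 (Set.Iic 0) = 0 := by
  rw [gammaMeasure, withDensity_apply _ measurableSet_Iic, setLIntegral_congr Iio_ae_eq_Iic.symm]
  exact lintegral_gammaPDF_of_nonpos le_rfl

lemma gammaMeasure_singleton (a x : ℝ) : gammaMeasure a 1 {x} = 0 :=
  withDensity_absolutelyContinuous _ _ Real.volume_singleton

lemma ae_gammaMeasure_pos (a : ℝ) : ∀ᵐ x ∂gammaMeasure a 1, 0 < x := by
  rw [ae_iff]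
  simpa [← Set.Iic_def] using gammaMeasure_apply_Iic_zero a

lemma integral_gammaMeasure {E : Type*} [NormedAddCommGroup E] [NormedSpace ℝ E]
    {a : ℝ} (ha : 0 < a) (f : ℝ → E) :
    ∫ x, f x ∂gammaMeasure a 1 =
      ∫ x in Set.Ioi 0, (x ^ (a - 1) * Real.exp (-x) / Real.Gamma a) • f x := by
  have h : gammaMeasure a 1 = volume.withDensity (fun x => ENNReal.ofReal (gammaPDFReal a 1 x)) :=
    rfl
  rw [h, integral_withDensity_eq_integral_toReal_smul
    (measurable_gammaPDFReal a 1).ennreal_ofReal (by simp)]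
  simp_rw [ENNReal.toReal_ofReal (gammaPDFReal_nonneg ha one_pos _)]
  rw [← integral_Ici_eq_integral_Ioi, ← integral_indicator measurableSet_Ici]
  congr 1 with x
  by_cases hx : 0 ≤ x
  · simp only [gammaPDFReal, hx, if_true, Set.indicator_of_mem (Set.mem_Ici.2 hx), Real.one_rpow,
      one_mul]
    congr 1; ring
  · simp [gammaPDFReal, hx]

lemma integral_pow_gammaMeasure {a : ℝ} (ha : 0 < a) (k : ℕ) :
    ∫ x, x ^ k ∂gammaMeasure a 1 = Real.Gamma (a + k) / Real.Gamma a := by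
  have hk : 0 < a + k := by positivity
  rw [integral_gammaMeasure ha, Real.Gamma_eq_integral hk, ← integral_div]
  refine setIntegral_congr_fun measurableSet_Ioi fun x hx => ?_
  have hx : 0 < x := hx
  simp only [smul_eq_mul]
  rw [show a + k - 1 = (a - 1) + k by ring, Real.rpow_add hx, Real.rpow_natCast]
  ring

lemma integrable_pow_gammaMeasure {a : ℝ} (ha : 0 < a) (k : ℕ) :
    Integrable (fun x => x ^ k) (gammaMeasure a 1) := by
  have hk : 0 < a + k := by positivity
  refine Integrable.of_integral_ne_zero ?_
  rw [integral_pow_gammaMeasure ha]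
  have := Real.Gamma_pos_of_pos ha
  have := Real.Gamma_pos_of_pos hk
  positivity

lemma integral_pow_gammaMeasure_succ {a : ℝ} (ha : 0 < a) (k : ℕ) :
    ∫ x, x ^ (k + 1) ∂gammaMeasure a 1 = (a + k) * ∫ x, x ^ k ∂gammaMeasure a 1 := by
  have hk : 0 < a + k := by positivity
  rw [integral_pow_gammaMeasure ha, integral_pow_gammaMeasure ha, Nat.cast_succ, ← add_assoc,
    Real.Gamma_add_one hk.ne', mul_div_assoc]

lemma integral_fourth_central_gammaMeasure {a : ℝ} (ha : 0 < a) :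
    Integrable (fun x => (x - a) ^ 4) (gammaMeasure a 1) ∧
      ∫ x, (x - a) ^ 4 ∂gammaMeasure a 1 = 3 * a ^ 2 + 6 * a := by
  have := isProbabilityMeasure_gammaMeasure ha one_pos
  have h0 : ∫ x : ℝ, x ^ 0 ∂gammaMeasure a 1 = 1 := by simp
  have h1 := integral_pow_gammaMeasure_succ ha 0
  have h2 := integral_pow_gammaMeasure_succ ha 1
  have h3 := integral_pow_gammaMeasure_succ ha 2
  have h4 := integral_pow_gammaMeasure_succ ha 3
  have g1 : ∫ x : ℝ, x ^ 1 ∂gammaMeasure a 1 = a := h1.trans (by rw [h0]; simp)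
  have g2 := h2.trans (by rw [g1])
  have g3 := h3.trans (by rw [g2])
  have g4 := h4.trans (by rw [g3])
  norm_num at g2 g3 g4
  have i1 := (integrable_pow_gammaMeasure ha 1).const_mul (4 * a ^ 3)
  have i2 := (integrable_pow_gammaMeasure ha 2).const_mul (6 * a ^ 2)
  have i3 := (integrable_pow_gammaMeasure ha 3).const_mul (4 * a)
  have i4 := integrable_pow_gammaMeasure ha 4
  have i0 := integrable_const (μ := gammaMeasure a 1) (a ^ 4)
  have j1 : Integrable (fun x : ℝ => x ^ 4 - 4 * a * x ^ 3) (gammaMeasure a 1) := i4.sub i3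
  have j2 : Integrable (fun x : ℝ => x ^ 4 - 4 * a * x ^ 3 + 6 * a ^ 2 * x ^ 2)
    (gammaMeasure a 1) := j1.add i2
  have j3 : Integrable (fun x : ℝ => x ^ 4 - 4 * a * x ^ 3 + 6 * a ^ 2 * x ^ 2 - 4 * a ^ 3 * x ^ 1)
    (gammaMeasure a 1) := j2.sub i1
  have e : (fun x : ℝ => (x - a) ^ 4) =
      fun x => x ^ 4 - 4 * a * x ^ 3 + 6 * a ^ 2 * x ^ 2 - 4 * a ^ 3 * x ^ 1 + a ^ 4 := by
    ext x; ring
  simp only [e]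
  refine ⟨j3.add i0, ?_⟩
  rw [integral_add j3 i0, integral_sub j2 i1, integral_add j1 i2, integral_sub i4 i3]
  simp only [integral_const_mul, g1, g2, g3, g4, integral_const, probReal_univ,
    smul_eq_mul]
  ring

/-- Markov's inequality for the fourth central moment, with `3 a² + 6 a ≤ 15 a²` for `a ≥ 1/2`.
Chebyshev would only give order `1/a`, which is neither summable in the shape nor negligible after a
union bound over `n` vectors. -/
lemma gammaMeasure_tail {a δ : ℝ} (ha : 1 / 2 ≤ a) (hδ : 0 < δ) :
    (gammaMeasure a 1).real {x | δ ≤ |x / a - 1|} ≤ 15 / (δ ^ 4 * a ^ 2) := by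
  have ha0 : 0 < a := by linarith
  have := isProbabilityMeasure_gammaMeasure ha0 one_pos
  obtain ⟨hi, he⟩ := integral_fourth_central_gammaMeasure ha0
  have hm := mul_meas_ge_le_integral_of_nonneg (ae_of_all _ fun x => by positivity) hi
    ((δ * a) ^ 4)
  have hs : {x : ℝ | δ ≤ |x / a - 1|} ⊆ {x | (δ * a) ^ 4 ≤ (x - a) ^ 4} := by
    intro x hx
    simp only [Set.mem_ofPred_eq] at hx ⊢
    have : |x / a - 1| * a = |x - a| := by
      rw [← abs_of_pos ha0, ← abs_mul, abs_of_pos ha0]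
      congr 1; field_simp
    have h2 : δ * a ≤ |x - a| := by rw [← this]; gcongr
    calc (δ * a) ^ 4 ≤ |x - a| ^ 4 := by gcongr
      _ = (x - a) ^ 4 := by rw [Even.pow_abs (by decide)]
  have hle := measureReal_mono (μ := gammaMeasure a 1) hs
  rw [he] at hm
  rw [le_div_iff₀ (by positivity)]
  have h3 : (gammaMeasure a 1).real {x | δ ≤ |x / a - 1|} * (δ * a) ^ 4 ≤ 15 * a ^ 2 := by
    nlinarith [mul_le_mul_of_nonneg_left hle (show 0 ≤ (δ * a) ^ 4 by positivity)]
  have ha2 : 0 < a ^ 2 := by positivity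
  refine le_of_mul_le_mul_right ?_ ha2
  calc _ = (gammaMeasure a 1).real {x | δ ≤ |x / a - 1|} * (δ * a) ^ 4 := by ring
    _ ≤ _ := h3

lemma mgf_gammaMeasure {a t : ℝ} (ha : 0 < a) (ht : t < 1) :
    mgf id (gammaMeasure a 1) t = (1 / (1 - t)) ^ a := by
  have hG := Real.Gamma_pos_of_pos ha
  rw [mgf, integral_gammaMeasure ha]
  have h := Real.integral_rpow_mul_exp_neg_mul_Ioi ha (sub_pos.2 ht)
  rw [← mul_div_cancel_right₀ ((1 / (1 - t)) ^ a) hG.ne', ← h, ← integral_div]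
  refine setIntegral_congr_fun measurableSet_Ioi fun x _ => ?_
  simp only [smul_eq_mul, id]
  rw [show -((1 - t) * x) = -x + t * x by ring, Real.exp_add]
  ring

/-- The integrand dominates a multiple of `x ^ (a - 1)`, which is not integrable on the half-line,
so the integral takes its default value `0`. This makes it possible to compare moment generating
functions as functions on all of `ℝ`. -/
lemma mgf_gammaMeasure_of_one_le {a t : ℝ} (ha : 0 < a) (ht : 1 ≤ t) :
    mgf id (gammaMeasure a 1) t = 0 := by
  have hG := Real.Gamma_pos_of_pos ha
  rw [mgf, integral_gammaMeasure ha]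
  refine integral_undef fun h => not_integrableOn_Ioi_rpow (a - 1) ?_
  refine Integrable.mono' (h.mul_const (Real.Gamma a)) (by fun_prop) ?_
  refine (ae_restrict_iff' measurableSet_Ioi).2 (ae_of_all _ fun x hx => ?_)
  have hx : 0 < x := hx
  have hp := Real.rpow_pos_of_pos hx (a - 1)
  rw [Real.norm_of_nonneg hp.le, smul_eq_mul, id]
  have : x ^ (a - 1) * Real.exp (-x) / Real.Gamma a * Real.exp (t * x) * Real.Gamma a =
      x ^ (a - 1) * Real.exp (-x + t * x) := by
    rw [Real.exp_add]; field_simp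
  rw [this]
  refine le_mul_of_one_le_right hp.le (Real.one_le_exp ?_)
  nlinarith

/-! ### Gaussian vectors: norms and projections -/

/-- Valid for every `t`: for `t ≥ 1` both sides are `0`, the left as an undefined integral, the
right as the root of a nonpositive number. -/
lemma mgf_sq_gaussianReal (t : ℝ) :
    mgf (fun x => x ^ 2 / 2) (gaussianReal 0 1) t = √(1 / (1 - t)) := by
  rw [mgf, integral_gaussianReal_eq_integral_smul one_ne_zero]
  have h := integral_gaussian ((1 - t) / 2)
  have e : ∀ x : ℝ, gaussianPDFReal 0 1 x • Real.exp (t * (x ^ 2 / 2)) =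
      (√(2 * Real.pi))⁻¹ * Real.exp (-((1 - t) / 2) * x ^ 2) := by
    intro x
    rw [gaussianPDFReal, smul_eq_mul, mul_assoc, ← Real.exp_add]
    simp only [NNReal.coe_one, mul_one, sub_zero]
    congr 2; ring
  simp_rw [e]
  rw [integral_const_mul, h, ← Real.sqrt_inv, ← Real.sqrt_mul (by positivity)]
  congr 1
  have := Real.pi_pos
  rcases eq_or_ne (1 - t) 0 with h0 | h0
  · simp [h0]
  · field_simp

/-- The moment generating function extends analytically to a vertical strip containing the imaginary
axis, where it is the characteristic function. -/
lemma ext_of_mgf_id_eq {μ ν : Measure ℝ} [IsProbabilityMeasure μ] [IsProbabilityMeasure ν]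
    (h : mgf id μ = mgf id ν) (h0 : 0 ∈ interior (integrableExpSet id μ)) : μ = ν := by
  refine Measure.ext_of_charFun ?_
  ext t
  rw [← complexMGF_id_mul_I, ← complexMGF_id_mul_I]
  exact eqOn_complexMGF_of_mgf h (by simpa using h0)

lemma zero_mem_interior_integrableExpSet_gammaMeasure {a : ℝ} (ha : 0 < a) :
    0 ∈ interior (integrableExpSet id (gammaMeasure a 1)) := by
  have := isProbabilityMeasure_gammaMeasure ha one_pos
  refine mem_interior.2 ⟨Set.Iio 1, fun t ht => ?_, isOpen_Iio, by simp⟩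
  have ht : t < 1 := ht
  have h1 : 0 < 1 - t := by linarith
  rw [integrableExpSet, Set.mem_ofPred_eq, ← mgf_pos_iff, mgf_gammaMeasure ha ht]
  positivity

lemma map_norm_sq_stdGaussian (F : Type*) [NormedAddCommGroup F] [InnerProductSpace ℝ F]
    [FiniteDimensional ℝ F] [MeasurableSpace F] [BorelSpace F]
    (hF : 0 < Module.finrank ℝ F) :
    (stdGaussian F).map (fun x => ‖x‖ ^ 2 / 2) =
      gammaMeasure ((Module.finrank ℝ F : ℝ) / 2) 1 := by
  have ha : 0 < (Module.finrank ℝ F : ℝ) / 2 := by positivity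
  have := isProbabilityMeasure_gammaMeasure ha one_pos
  have : IsProbabilityMeasure ((stdGaussian F).map (fun x => ‖x‖ ^ 2 / 2)) :=
    Measure.isProbabilityMeasure_map (by fun_prop)
  refine (ext_of_mgf_id_eq ?_ (zero_mem_interior_integrableExpSet_gammaMeasure ha)).symm
  ext t
  rw [mgf_id_map (by fun_prop), stdGaussian, mgf.eq_def (μ := Measure.map _ _),
    integral_map (Measurable.aemeasurable (by fun_prop)) (by fun_prop)]
  have e : ∀ x : Fin (Module.finrank ℝ F) → ℝ,
      Real.exp (t * (‖∑ i, x i • stdOrthonormalBasis ℝ F i‖ ^ 2 / 2)) =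
        ∏ i, Real.exp (t * (x i ^ 2 / 2)) := by
    intro x
    rw [← Real.exp_sum, ← Finset.mul_sum, ← Finset.sum_div]
    congr 3
    rw [← (stdOrthonormalBasis ℝ F).sum_sq_norm_inner_right]
    simp [inner_sum, inner_smul_right, OrthonormalBasis.inner_eq_ite]
  simp_rw [e]
  rw [integral_fintype_prod_eq_prod (f := fun _ x => Real.exp (t * (x ^ 2 / 2)))]
  have h := mgf_sq_gaussianReal t
  rw [mgf] at h
  simp only [h, Finset.prod_const, Finset.card_univ, Fintype.card_fin]
  rcases lt_or_ge t 1 with ht | ht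
  · have h1 : 0 < 1 - t := by linarith
    rw [mgf_gammaMeasure ha ht, Real.sqrt_eq_rpow, ← Real.rpow_natCast, ← Real.rpow_mul (by positivity)]
    congr 1; ring
  · rw [mgf_gammaMeasure_of_one_le ha ht, Real.sqrt_eq_zero_of_nonpos, zero_pow hF.ne']
    exact one_div_nonpos.2 (by linarith)

lemma map_orthogonalProjection_stdGaussian {E : Type*} [NormedAddCommGroup E]
    [InnerProductSpace ℝ E] [FiniteDimensional ℝ E] [MeasurableSpace E] [BorelSpace E]
    (K : Submodule ℝ E) :
    (stdGaussian E).map K.orthogonalProjectionOnto = stdGaussian K := by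
  have : IsProbabilityMeasure ((stdGaussian E).map K.orthogonalProjectionOnto) :=
    Measure.isProbabilityMeasure_map (by fun_prop)
  refine Measure.ext_of_charFun ?_
  ext t
  rw [charFun_stdGaussian, charFun_apply, integral_map (by fun_prop) (by fun_prop)]
  have h := charFun_stdGaussian (t : E)
  rw [charFun_apply] at h
  simp only [Submodule.coe_norm] at h ⊢
  rw [← h]
  congr 1 with x
  rw [Submodule.inner_orthogonalProjectionOnto_eq_of_mem_right]

lemma map_norm_sq_orthogonalProjection_stdGaussian {E : Type*} [NormedAddCommGroup E]
    [InnerProductSpace ℝ E] [FiniteDimensional ℝ E] [MeasurableSpace E] [BorelSpace E]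
    (K : Submodule ℝ E) (hK : 0 < Module.finrank ℝ K) :
    (stdGaussian E).map (fun x => ‖K.orthogonalProjectionOnto x‖ ^ 2 / 2) =
      gammaMeasure ((Module.finrank ℝ K : ℝ) / 2) 1 := by
  rw [← map_norm_sq_stdGaussian K hK, ← map_orthogonalProjection_stdGaussian K,
    Measure.map_map (by fun_prop) (by fun_prop)]
  rfl

/-! ### Gram-Schmidt norms of independent Gaussian vectors -/

section GramSchmidt

variable {n p : ℕ}

/-- In this form the earlier vectors enter only through their span, which gives both the behaviour
under rescaling and the conditional law given the past. -/
lemma gsNormSq_eq (b : Fin p → EuclideanSpace ℝ (Fin n)) (i : Fin p) :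
    gsNormSq b i =
      ‖(Submodule.span ℝ (b '' Set.Iio i))ᗮ.orthogonalProjectionOnto (b i)‖ ^ 2 := by
  set V := Submodule.span ℝ (b '' Set.Iio i) with hV
  have h1 : InnerProductSpace.gramSchmidt ℝ b i ∈ Vᗮ := by
    rw [hV, Submodule.mem_orthogonal']
    intro u hu
    induction hu using Submodule.span_induction with
    | mem x hx =>
      obtain ⟨j, hj, rfl⟩ := hx
      exact InnerProductSpace.gramSchmidt_inv_triangular ℝ b hj
    | zero => simp
    | add x y _ _ hx hy => rw [inner_add_right, hx, hy, add_zero]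
    | smul c x _ hx => rw [inner_smul_right, hx, mul_zero]
  have h2 : b i - InnerProductSpace.gramSchmidt ℝ b i ∈ V := by
    rw [InnerProductSpace.gramSchmidt_def, sub_sub_cancel, hV,
      ← InnerProductSpace.span_gramSchmidt_Iio]
    refine Submodule.sum_mem _ fun j hj => ?_
    rw [Submodule.starProjection_singleton]
    exact Submodule.smul_mem _ _
      (Submodule.subset_span (Set.mem_image_of_mem _ (Finset.mem_Iio.1 hj)))
  have h3 : Vᗮ.starProjection (b i) = InnerProductSpace.gramSchmidt ℝ b i :=
    Submodule.eq_starProjection_of_mem_orthogonal h1 (Submodule.le_orthogonal_orthogonal V h2)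
  rw [gsNormSq, ← h3]
  rfl

lemma gsNormSq_nonneg (b : Fin p → EuclideanSpace ℝ (Fin n)) (i : Fin p) : 0 ≤ gsNormSq b i := by
  unfold gsNormSq; positivity

lemma gsNormSq_smul (b : Fin p → EuclideanSpace ℝ (Fin n)) (c : Fin p → ℝ) (hc : ∀ i, c i ≠ 0)
    (i : Fin p) : gsNormSq (fun j => c j • b j) i = c i ^ 2 * gsNormSq b i := by
  have h : Submodule.span ℝ ((fun j => c j • b j) '' Set.Iio i) =
      Submodule.span ℝ (b '' Set.Iio i) := by
    refine le_antisymm (Submodule.span_le.2 ?_) (Submodule.span_le.2 ?_)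
    · rintro _ ⟨j, hj, rfl⟩
      exact Submodule.smul_mem _ _ (Submodule.subset_span ⟨j, hj, rfl⟩)
    · rintro _ ⟨j, hj, rfl⟩
      have : b j = (c j)⁻¹ • (c j • b j) := by rw [smul_smul, inv_mul_cancel₀ (hc j), one_smul]
      rw [this]
      exact Submodule.smul_mem _ _ (Submodule.subset_span ⟨j, hj, rfl⟩)
  rw [gsNormSq_eq, gsNormSq_eq, h, map_smul, norm_smul, mul_pow, Real.norm_eq_abs, sq_abs]

lemma gsNormSq_castSucc (b : Fin (p + 1) → EuclideanSpace ℝ (Fin n)) (i : Fin p) :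
    gsNormSq b i.castSucc = gsNormSq (fun j => b j.castSucc) i := by
  have h : b '' Set.Iio i.castSucc = (fun j => b j.castSucc) '' Set.Iio i := by
    ext v
    constructor
    · rintro ⟨j, hj, rfl⟩
      have hj' : (j : ℕ) < i := hj
      exact ⟨⟨j, hj'.trans i.2⟩, hj', rfl⟩
    · rintro ⟨j, hj, rfl⟩
      exact ⟨j.castSucc, hj, rfl⟩
  rw [gsNormSq_eq, gsNormSq_eq, h]

lemma gsNormSq_snoc_last (b : Fin p → EuclideanSpace ℝ (Fin n)) (x : EuclideanSpace ℝ (Fin n)) :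
    gsNormSq (Fin.snoc b x : Fin (p + 1) → EuclideanSpace ℝ (Fin n)) (Fin.last p) =
      ‖(Submodule.span ℝ (Set.range b))ᗮ.orthogonalProjectionOnto x‖ ^ 2 := by
  have h : (Fin.snoc b x : Fin (p + 1) → EuclideanSpace ℝ (Fin n)) '' Set.Iio (Fin.last p) =
      Set.range b := by
    ext v
    constructor
    · rintro ⟨j, hj, rfl⟩
      have hj' : (j : ℕ) < p := hj
      exact ⟨⟨j, hj'⟩, (Fin.snoc_castSucc (α := fun _ => EuclideanSpace ℝ (Fin n)) x b
        ⟨j, hj'⟩).symm⟩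
    · rintro ⟨j, rfl⟩
      exact ⟨j.castSucc, Fin.castSucc_lt_last j, by rw [Fin.snoc_castSucc]⟩
  rw [gsNormSq_eq, h, Fin.snoc_last]

lemma measurable_gramSchmidt (i : Fin p) :
    Measurable fun b : Fin p → EuclideanSpace ℝ (Fin n) =>
      InnerProductSpace.gramSchmidt ℝ b i := by
  induction i using WellFoundedLT.induction with
  | ind i ih =>
    have e : (fun b : Fin p → EuclideanSpace ℝ (Fin n) => InnerProductSpace.gramSchmidt ℝ b i) =
        fun b => b i - ∑ j ∈ Finset.Iio i, (inner ℝ (InnerProductSpace.gramSchmidt ℝ b j) (b i) /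
          ‖InnerProductSpace.gramSchmidt ℝ b j‖ ^ 2) • InnerProductSpace.gramSchmidt ℝ b j := by
      ext1 b
      rw [InnerProductSpace.gramSchmidt_def]
      simp only [Submodule.starProjection_singleton]
      rfl
    rw [e]
    refine (measurable_pi_apply i).sub (Finset.measurable_sum _ fun j hj => ?_)
    have hj := ih j (Finset.mem_Iio.1 hj)
    exact Measurable.smul ((hj.inner (measurable_pi_apply i)).div (hj.norm.pow_const 2)) hj

lemma measurable_gsNormSq (i : Fin p) :
    Measurable fun b : Fin p → EuclideanSpace ℝ (Fin n) => gsNormSq b i :=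
  (measurable_gramSchmidt i).norm.pow_const 2

lemma finrank_orthogonal_span_range (b : Fin p → EuclideanSpace ℝ (Fin n))
    (h : ∀ i, 0 < gsNormSq b i) :
    Module.finrank ℝ (Submodule.span ℝ (Set.range b))ᗮ = n - p := by
  have hli : LinearIndependent ℝ (InnerProductSpace.gramSchmidt ℝ b) := by
    refine linearIndependent_of_ne_zero_of_inner_eq_zero (𝕜 := ℝ) (fun i h0 => ?_)
      fun i j hij => InnerProductSpace.gramSchmidt_orthogonal ℝ b hij
    have := h i
    simp [gsNormSq, h0] at this
  have h1 := finrank_span_eq_card hli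
  rw [InnerProductSpace.span_gramSchmidt, Fintype.card_fin] at h1
  have h2 := (Submodule.span ℝ (Set.range b)).finrank_add_finrank_orthogonal
  rw [finrank_euclideanSpace_fin, h1] at h2
  omega

lemma ae_pi_gammaMeasure_pos (a : Fin p → ℝ) (ha : ∀ i, 0 < a i) :
    ∀ᵐ y ∂Measure.pi (fun i => gammaMeasure (a i) 1), ∀ i, 0 < y i := by
  have := fun i => isProbabilityMeasure_gammaMeasure (ha i) one_pos
  refine ae_all_iff.2 fun i => ?_
  exact (Measure.quasiMeasurePreserving_eval (fun i => gammaMeasure (a i) 1) i).ae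
    (ae_gammaMeasure_pos (a i))

/-- The squared norms of the Gram-Schmidt vectors of independent standard Gaussian vectors are
independent, with gamma laws (up to the factor `2`). -/
lemma measurePreserving_gsNormSq_stdGaussian (hp : p ≤ n) :
    MeasurePreserving
      (fun (b : Fin p → EuclideanSpace ℝ (Fin n)) i => gsNormSq b i / 2)
      (Measure.pi fun _ => stdGaussian (EuclideanSpace ℝ (Fin n)))
      (Measure.pi fun i : Fin p => gammaMeasure (((n - (i : ℕ) : ℕ) : ℝ) / 2) 1) := by
  have hpos : ∀ q, q < n → (0 : ℝ) < ((n - q : ℕ) : ℝ) / 2 := fun q hq => by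
    have : 0 < n - q := by omega
    positivity
  induction p with
  | zero =>
    refine ⟨measurable_pi_lambda _ fun i => i.elim0, ?_⟩
    rw [Measure.pi_of_empty, Measure.pi_of_empty, Measure.map_dirac' (measurable_pi_lambda _ fun i => i.elim0)]
    congr 1
    exact Subsingleton.elim _ _
  | succ p ih =>
    have hf := ih (by omega)
    have hprob : ∀ q, q < n → IsProbabilityMeasure (gammaMeasure (((n - q : ℕ) : ℝ) / 2) 1) :=
      fun q hq => isProbabilityMeasure_gammaMeasure (hpos q hq) one_pos
    have : ∀ i : Fin (p + 1),
        IsProbabilityMeasure (gammaMeasure (((n - (i : ℕ) : ℕ) : ℝ) / 2) 1) :=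
      fun i => hprob i (by omega)
    have : ∀ i : Fin p,
        IsProbabilityMeasure (gammaMeasure (((n - (i : ℕ) : ℕ) : ℝ) / 2) 1) :=
      fun i => hprob i (by omega)
    have : IsProbabilityMeasure (gammaMeasure (((n - p : ℕ) : ℝ) / 2) 1) := hprob p (by omega)
    -- Conditioning on the first `p` vectors: the law of the last norm is the same gamma law for
    -- almost every `b`, hence independent of the earlier norms.
    have hskew := hf.skew_product (μc := stdGaussian (EuclideanSpace ℝ (Fin n)))
      (μd := gammaMeasure (((n - p : ℕ) : ℝ) / 2) 1)
      (g := fun b x => gsNormSq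
        (Fin.snoc b x : Fin (p + 1) → EuclideanSpace ℝ (Fin n)) (Fin.last p) / 2) (by
        have : Measurable fun z : (Fin p → EuclideanSpace ℝ (Fin n)) × EuclideanSpace ℝ (Fin n) =>
            (Fin.snoc z.1 z.2 : Fin (p + 1) → EuclideanSpace ℝ (Fin n)) := by
          refine measurable_pi_lambda _ fun i => ?_
          refine Fin.lastCases ?_ (fun j => ?_) i
          · simpa using measurable_snd
          · simpa using! (measurable_pi_apply j).comp measurable_fst
        exact ((measurable_gsNormSq (Fin.last p)).comp this).div_const 2) (by
        -- By the induction hypothesis the earlier norms are almost surely positive, so the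
        -- orthogonal complement has dimension exactly `n - p`.
        filter_upwards [hf.quasiMeasurePreserving.ae
          (ae_pi_gammaMeasure_pos _ fun i : Fin p => hpos i (by omega))] with b hb
        have hb : ∀ i, 0 < gsNormSq b i := fun i => by
          have := hb i
          linarith
        have hr := finrank_orthogonal_span_range b hb
        simp_rw [gsNormSq_snoc_last]
        rw [map_norm_sq_orthogonalProjection_stdGaussian _ (by rw [hr]; omega), hr])
    have h1 := measurePreserving_piFinSuccAbove
      (fun _ : Fin (p + 1) => stdGaussian (EuclideanSpace ℝ (Fin n))) (Fin.last p)
    have h2 := (measurePreserving_piFinSuccAbove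
      (fun i : Fin (p + 1) => gammaMeasure (((n - (i : ℕ) : ℕ) : ℝ) / 2) 1) (Fin.last p)).symm
    simp only [Fin.succAbove_last, Fin.val_castSucc, Fin.val_last] at h1 h2
    -- The swaps are needed because `piFinSuccAbove` puts the last coordinate first.
    have h3 := h2.comp ((Measure.measurePreserving_swap.comp hskew).comp
      (Measure.measurePreserving_swap.comp h1))
    convert h3 using 1
    ext b i
    refine Fin.lastCases ?_ (fun j => ?_) i
    · simp [MeasurableEquiv.piFinSuccAbove]
    · simp only [MeasurableEquiv.piFinSuccAbove, gsNormSq_castSucc]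
      simp
      rfl

end GramSchmidt

/-! ### Rotation invariant laws -/

section Rotation

variable {E : Type*} [NormedAddCommGroup E] [InnerProductSpace ℝ E]

lemma exists_linearIsometryEquiv_apply_eq [FiniteDimensional ℝ E] {x y : E} (h : ‖x‖ = ‖y‖) :
    ∃ U : E ≃ₗᵢ[ℝ] E, U x = y :=
  ⟨(ℝ ∙ (x - y))ᗮ.reflection, Submodule.reflection_sub h⟩

variable [FiniteDimensional ℝ E] [MeasurableSpace E] [BorelSpace E]

lemma charFun_eq_of_norm_eq {μ : Measure E} (hμ : ∀ U : E ≃ₗᵢ[ℝ] E, μ.map U = μ) {s t : E}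
    (h : ‖s‖ = ‖t‖) : charFun μ s = charFun μ t := by
  obtain ⟨U, rfl⟩ := exists_linearIsometryEquiv_apply_eq h
  conv_rhs => rw [← hμ U]
  rw [charFun_apply, charFun_apply, integral_map (by fun_prop) (by fun_prop)]
  simp

lemma ae_ne_zero_stdGaussian (hE : 0 < Module.finrank ℝ E) : ∀ᵐ y ∂stdGaussian E, y ≠ 0 := by
  have h := ae_gammaMeasure_pos ((Module.finrank ℝ E : ℝ) / 2)
  rw [← map_norm_sq_stdGaussian E hE, ae_map_iff (by fun_prop) measurableSet_Ioi] at h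
  filter_upwards [h] with y hy h0
  simp [h0] at hy

/-- A rotation invariant law is determined by the law of the norm. -/
lemma ext_of_map_norm_eq (hE : 0 < Module.finrank ℝ E) {μ ν : Measure E} [IsProbabilityMeasure μ]
    [IsProbabilityMeasure ν] (hμ : ∀ U : E ≃ₗᵢ[ℝ] E, μ.map U = μ)
    (hν : ∀ U : E ≃ₗᵢ[ℝ] E, ν.map U = ν) (h : μ.map norm = ν.map norm) : μ = ν := by
  have hne : Nontrivial E := Module.nontrivial_of_finrank_pos hE
  obtain ⟨e, he⟩ := exists_norm_eq E zero_le_one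
  refine Measure.ext_of_charFun ?_
  ext t
  -- The characteristic function at `t` is averaged over the random directions `‖t‖ • y / ‖y‖`. By
  -- invariance the average changes nothing; after Fubini the inner average `F` is radial, so only
  -- the law of the norm enters.
  let F : E → ℂ := fun x => ∫ y, Complex.exp
    ((inner ℝ x (‖t‖ • ‖y‖⁻¹ • y) : ℝ) * Complex.I) ∂stdGaussian E
  have hF : ∀ x, F x = F (‖x‖ • e) := by
    intro x
    obtain ⟨U, hU⟩ := exists_linearIsometryEquiv_apply_eq (x := ‖x‖ • e) (y := x)
      (by simp [norm_smul, he])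
    conv_lhs => rw [← hU]
    simp only [F]
    conv_lhs => rw [← stdGaussian_map U]
    rw [integral_map (by fun_prop) (by fun_prop)]
    congr 1 with y
    simp only [LinearIsometryEquiv.norm_map, ← map_smul, LinearIsometryEquiv.inner_map_map]
  have hm : Measurable fun z : E × E => Complex.exp
      ((inner ℝ z.1 (‖t‖ • ‖z.2‖⁻¹ • z.2) : ℝ) * Complex.I) := by fun_prop
  have hFm : StronglyMeasurable F := hm.stronglyMeasurable.integral_prod_right
  have key : ∀ (ρ : Measure E) [IsProbabilityMeasure ρ], (∀ U : E ≃ₗᵢ[ℝ] E, ρ.map U = ρ) →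
      charFun ρ t = ∫ r, F (r • e) ∂(ρ.map norm) := by
    intro ρ _ hρ
    have h1 : charFun ρ t = ∫ y, charFun ρ (‖t‖ • ‖y‖⁻¹ • y) ∂stdGaussian E := by
      have h2 : (fun y => charFun ρ (‖t‖ • ‖y‖⁻¹ • y)) =ᵐ[stdGaussian E] fun _ => charFun ρ t := by
        filter_upwards [ae_ne_zero_stdGaussian hE] with y hy
        refine charFun_eq_of_norm_eq hρ ?_
        have : ‖y‖ ≠ 0 := norm_ne_zero_iff.2 hy
        simp [norm_smul, this]
      rw [integral_congr_ae h2]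
      simp
    rw [h1]
    simp_rw [charFun_apply]
    rw [integral_integral_swap, integral_map (by fun_prop)]
    · exact integral_congr_ae (ae_of_all _ hF)
    · exact (hFm.comp_measurable (by fun_prop)).aestronglyMeasurable
    · refine Integrable.of_bound (C := 1) ?_ (ae_of_all _ fun z => ?_)
      · exact (hm.comp measurable_swap).aestronglyMeasurable
      · simp only [Function.uncurry]
        rw [Complex.norm_exp_ofReal_mul_I]
  rw [key μ hμ, key ν hν, h]

/-- Rescale `y` to the norm of `x`. -/
noncomputable def transferNorm (z : E × E) : E := (‖z.1‖ / ‖z.2‖) • z.2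

@[fun_prop]
lemma measurable_transferNorm : Measurable (transferNorm (E := E)) := by
  unfold transferNorm; fun_prop

/-- The image is invariant because rotating the Gaussian component alone rotates the output, and its
norm is almost surely that of the first component; `ext_of_map_norm_eq` concludes. -/
lemma map_transferNorm (hE : 0 < Module.finrank ℝ E) {ν : Measure E} [IsProbabilityMeasure ν]
    (hν : ∀ U : E ≃ₗᵢ[ℝ] E, ν.map U = ν) :
    (ν.prod (stdGaussian E)).map transferNorm = ν := by
  have : IsProbabilityMeasure ((ν.prod (stdGaussian E)).map transferNorm) :=
    Measure.isProbabilityMeasure_map (by fun_prop)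
  refine ext_of_map_norm_eq hE (fun U => ?_) hν ?_
  · have h : MeasurePreserving (Prod.map id U) (ν.prod (stdGaussian E)) (ν.prod (stdGaussian E)) :=
      (MeasurePreserving.id ν).prod ⟨by fun_prop, stdGaussian_map U⟩
    conv_rhs => rw [← h.map_eq]
    rw [Measure.map_map (by fun_prop) (by fun_prop), Measure.map_map (by fun_prop) h.measurable]
    congr 1
    ext1 z
    simp [transferNorm]
  · have h : ∀ᵐ z ∂ν.prod (stdGaussian E), z.2 ≠ 0 :=
      Measure.quasiMeasurePreserving_snd.ae (ae_ne_zero_stdGaussian hE)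
    rw [Measure.map_map (by fun_prop) (by fun_prop)]
    have h2 : (norm ∘ transferNorm (E := E)) =ᵐ[ν.prod (stdGaussian E)] fun z => ‖z.1‖ := by
      filter_upwards [h] with z hz
      have : ‖z.2‖ ≠ 0 := norm_ne_zero_iff.2 hz
      simp [transferNorm, norm_smul, this]
    rw [Measure.map_congr h2]
    conv_rhs => rw [← (measurePreserving_fst (μ := ν) (ν := stdGaussian E)).map_eq]
    rw [Measure.map_map (by fun_prop) (by fun_prop)]
    rfl

end Rotation

/-! ### Coupling a spherical model with the Gaussian model -/

lemma measurable_localRatio {n p : ℕ} :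
    Measurable (localRatio : (Fin p → EuclideanSpace ℝ (Fin n)) → Fin (p - 1) → ℝ) :=
  measurable_pi_lambda _ fun _ => (measurable_gsNormSq _).div (measurable_gsNormSq _)

/-- The rescaling multiplies each ratio by a quotient of two products of two normalised squared
norms. All four factors lie in `(1 - δ, 1 + δ)`, whence the square. -/
lemma localRatio_transferNorm_mem {n p : ℕ} (hn : 1 ≤ n) {a δ : ℝ} (hδ1 : δ < 1)
    (x y : Fin p → EuclideanSpace ℝ (Fin n)) (hx : ∀ i, |‖x i‖ ^ 2 / a - 1| < δ)
    (hy : ∀ i, |‖y i‖ ^ 2 / n - 1| < δ) (i : Fin (p - 1)) :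
    localRatio y i / ((1 + δ) / (1 - δ)) ^ 2 ≤
        localRatio (fun j => transferNorm (x j, y j)) i ∧
      localRatio (fun j => transferNorm (x j, y j)) i ≤
        ((1 + δ) / (1 - δ)) ^ 2 * localRatio y i := by
  have hn0 : (0 : ℝ) < n := by exact_mod_cast hn
  have hδ0 : 0 < 1 - δ := by linarith
  have hδ : 0 < 1 + δ := by
    have := (abs_nonneg _).trans_lt (hx ⟨i, by omega⟩)
    linarith
  have hu : ∀ j, 1 - δ < ‖x j‖ ^ 2 / a ∧ ‖x j‖ ^ 2 / a < 1 + δ := fun j => by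
    have := abs_lt.1 (hx j); constructor <;> linarith
  have hv : ∀ j, 1 - δ < ‖y j‖ ^ 2 / n ∧ ‖y j‖ ^ 2 / n < 1 + δ := fun j => by
    have := abs_lt.1 (hy j); constructor <;> linarith
  have hx0 : ∀ j, ‖x j‖ ≠ 0 := fun j h => by
    have := (hu j).1; simp [h] at this; linarith
  have hy0 : ∀ j, ‖y j‖ ≠ 0 := fun j h => by
    have := (hv j).1; simp [h] at this; linarith
  have ha0 : a ≠ 0 := fun h => by
    have := (hu ⟨i, by omega⟩).1; simp [h] at this; linarith
  have hgs := gsNormSq_smul y (fun j => ‖x j‖ / ‖y j‖) (fun j => div_ne_zero (hx0 j) (hy0 j))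
  have he : localRatio (fun j => transferNorm (x j, y j)) i =
      (‖x ⟨i + 1, by omega⟩‖ / ‖y ⟨i + 1, by omega⟩‖) ^ 2 /
        (‖x ⟨i, by omega⟩‖ / ‖y ⟨i, by omega⟩‖) ^ 2 * localRatio y i := by
    simp only [localRatio, transferNorm, hgs]
    rw [mul_div_mul_comm]
  rw [he]
  have hr : 0 ≤ localRatio y i := div_nonneg (gsNormSq_nonneg _ _) (gsNormSq_nonneg _ _)
  obtain ⟨hu1, hu2⟩ := hu ⟨i, by omega⟩
  obtain ⟨hu3, hu4⟩ := hu ⟨i + 1, by omega⟩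
  obtain ⟨hv1, hv2⟩ := hv ⟨i, by omega⟩
  obtain ⟨hv3, hv4⟩ := hv ⟨i + 1, by omega⟩
  have hy1 := hy0 ⟨i, by omega⟩
  have hy2 := hy0 ⟨i + 1, by omega⟩
  have hx1 := hx0 ⟨i, by omega⟩
  have hx2 := hx0 ⟨i + 1, by omega⟩
  have hq : (‖x ⟨i + 1, by omega⟩‖ / ‖y ⟨i + 1, by omega⟩‖) ^ 2 /
        (‖x ⟨i, by omega⟩‖ / ‖y ⟨i, by omega⟩‖) ^ 2 =
      (‖x ⟨i + 1, by omega⟩‖ ^ 2 / a) * (‖y ⟨i, by omega⟩‖ ^ 2 / n) /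
        ((‖y ⟨i + 1, by omega⟩‖ ^ 2 / n) * (‖x ⟨i, by omega⟩‖ ^ 2 / a)) := by
    field_simp
  rw [hq]
  generalize ‖x ⟨i + 1, by omega⟩‖ ^ 2 / a = u' at *
  generalize ‖x ⟨i, by omega⟩‖ ^ 2 / a = u at *
  generalize ‖y ⟨i + 1, by omega⟩‖ ^ 2 / (n : ℝ) = v' at *
  generalize ‖y ⟨i, by omega⟩‖ ^ 2 / (n : ℝ) = v at *
  have hu0 : 0 < u := by linarith
  have hv0 : 0 < v := by linarith
  have hu0' : 0 < u' := by linarith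
  have hv0' : 0 < v' := by linarith
  constructor
  · rw [div_eq_inv_mul, ← inv_pow, inv_div, div_pow, pow_two, pow_two]
    gcongr
  · rw [div_pow, pow_two, pow_two]
    gcongr

lemma stdGaussian_norm_sq_tail {n : ℕ} (hn : 1 ≤ n) {δ : ℝ} (hδ : 0 < δ) :
    (stdGaussian (EuclideanSpace ℝ (Fin n))).real {y | δ ≤ |‖y‖ ^ 2 / n - 1|} ≤
      60 / (δ ^ 4 * (n : ℝ) ^ 2) := by
  have hn' : (1 : ℝ) ≤ n := by exact_mod_cast hn
  have h := gammaMeasure_tail (a := (n : ℝ) / 2) (by linarith) hδ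
  have hl := map_norm_sq_stdGaussian (EuclideanSpace ℝ (Fin n)) (by rw [finrank_euclideanSpace_fin]; omega)
  rw [finrank_euclideanSpace_fin] at hl
  rw [← hl, map_measureReal_apply (by fun_prop)
    (measurableSet_le measurable_const (by fun_prop))] at h
  refine (le_of_eq ?_).trans (h.trans (le_of_eq ?_))
  · congr 1
    ext y
    simp only [Set.mem_preimage, Set.mem_ofPred_eq]
    rw [div_div_div_cancel_right₀ two_ne_zero]
  · field_simp
    norm_num

/-- The sequence of consecutive ratios in a spherical model can be coupled with that of the
standard Gaussian model so that they are uniformly close with high probability. -/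
theorem exists_ratio_coupling (ν : ∀ n : ℕ, Measure (EuclideanSpace ℝ (Fin n)))
    (hν : IsSpherical ν) (hconc : RadialConcentration ν) {κ ε : ℝ} (hκ : 1 < κ) (hε : 0 < ε) :
    ∀ᶠ n in atTop, ∀ p ≤ n, ∃ Q : Measure ((Fin (p - 1) → ℝ) × (Fin (p - 1) → ℝ)),
      Q.map Prod.fst = (Measure.pi fun _ : Fin p => ν n).map localRatio ∧
      Q.map Prod.snd =
        (Measure.pi fun _ : Fin p => stdGaussian (EuclideanSpace ℝ (Fin n))).map localRatio ∧
      Q {z | ¬ ∀ i, z.2 i / κ ≤ z.1 i ∧ z.1 i ≤ κ * z.2 i} ≤ ENNReal.ofReal ε := by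
  obtain ⟨a, d₁, d₂, α, ρ₀, -, hd₁, hd₂, hα, hρ₀, hρ₁, hconc⟩ := hconc
  obtain ⟨δ, hδ0, hδρ, hδκ⟩ : ∃ δ : ℝ, 0 < δ ∧ δ < ρ₀ ∧ ((1 + δ) / (1 - δ)) ^ 2 < κ := by
    have hc : Tendsto (fun δ : ℝ => ((1 + δ) / (1 - δ)) ^ 2) (𝓝[>] 0) (𝓝 1) := by
      have : ContinuousAt (fun δ : ℝ => ((1 + δ) / (1 - δ)) ^ 2) 0 := by
        refine ContinuousAt.pow (ContinuousAt.div (by fun_prop) (by fun_prop) (by norm_num)) 2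
      have h := this.tendsto
      norm_num at h
      exact h.mono_left nhdsWithin_le_nhds
    obtain ⟨δ, h1, h2, h3⟩ := ((hc.eventually_lt_const hκ).and
      ((Ioo_mem_nhdsGT hρ₀ : ∀ᶠ δ : ℝ in 𝓝[>] 0, δ ∈ Set.Ioo 0 ρ₀))).exists
    exact ⟨δ, h2, h3, h1⟩
  have hδ1 : δ < 1 := hδρ.trans hρ₁
  -- The leading factor `n` pays for the union bound over `p ≤ n` vectors.
  have hlim : Tendsto (fun n : ℕ => (n : ℝ) * (d₁ * Real.exp (-((n : ℝ) * d₂ * δ ^ α)) +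
      60 / (δ ^ 4 * (n : ℝ) ^ 2))) atTop (𝓝 0) := by
    have hb : 0 < d₂ * δ ^ α := by positivity
    have h1 := ((tendsto_rpow_mul_exp_neg_mul_atTop_nhds_zero 1 _ hb).comp
      tendsto_natCast_atTop_atTop).const_mul d₁
    have h2 := (tendsto_inv_atTop_zero.comp (tendsto_natCast_atTop_atTop (R := ℝ))).const_mul
      (60 / δ ^ 4)
    have h3 := h1.add h2
    rw [mul_zero, mul_zero, add_zero] at h3
    refine h3.congr' ?_
    filter_upwards [eventually_gt_atTop 0] with n hn
    have hn0 : (0 : ℝ) < n := by exact_mod_cast hn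
    simp only [Function.comp, Real.rpow_one]
    rw [show -((n : ℝ) * d₂ * δ ^ α) = -(d₂ * δ ^ α) * n by ring]
    field_simp
  filter_upwards [hlim.eventually_lt_const hε, eventually_ge_atTop 1] with n hnε hn p hp
  have hs := hν n hn
  have := hs.isProbabilityMeasure
  set E := EuclideanSpace ℝ (Fin n)
  set μ : Measure (Fin p → E × E) := Measure.pi fun _ => (ν n).prod (stdGaussian E)
  have hfr : 0 < Module.finrank ℝ E := by rw [finrank_euclideanSpace_fin]; omega
  have hm1 : Measurable fun w : Fin p → E × E => fun j => transferNorm (w j) := by fun_prop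
  have hm2 : Measurable fun w : Fin p → E × E => fun j => (w j).2 := by fun_prop
  have hl := measurable_localRatio (n := n) (p := p)
  have hpair : Measurable fun w : Fin p → E × E =>
    (localRatio (fun j => transferNorm (w j)), localRatio fun j => (w j).2) :=
    (hl.comp hm1).prodMk (hl.comp hm2)
  -- The coupling uses the same Gaussian vectors twice: rescaled to the norms of the `ν n` vectors,
  -- and as they are.
  refine ⟨μ.map fun w =>
    (localRatio (fun j => transferNorm (w j)), localRatio fun j => (w j).2), ?_, ?_, ?_⟩
  · have h := Measure.pi_map_pi (μ := fun _ : Fin p => (ν n).prod (stdGaussian E))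
      (f := fun _ => transferNorm) (fun _ => by fun_prop)
    simp only [map_transferNorm hfr hs.map_isometry] at h
    rw [Measure.map_map measurable_fst hpair, ← h, Measure.map_map hl hm1]
    rfl
  · have h := Measure.pi_map_pi (μ := fun _ : Fin p => (ν n).prod (stdGaussian E))
      (f := fun _ => Prod.snd) (fun _ => by fun_prop)
    simp only [measurePreserving_snd.map_eq] at h
    rw [Measure.map_map measurable_snd hpair, ← h, Measure.map_map hl hm2]
    rfl
  · have hB : ∀ j, μ {w | δ ≤ |‖(w j).1‖ ^ 2 / a n - 1| ∨ δ ≤ |‖(w j).2‖ ^ 2 / n - 1|} ≤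
        ENNReal.ofReal (d₁ * Real.exp (-((n : ℝ) * d₂ * δ ^ α)) + 60 / (δ ^ 4 * (n : ℝ) ^ 2)) := by
      intro j
      have e1 : MeasurePreserving (fun w : Fin p → E × E => (w j).1) μ (ν n) :=
        measurePreserving_fst.comp
          (measurePreserving_eval (fun _ : Fin p => (ν n).prod (stdGaussian E)) j)
      have e2 : MeasurePreserving (fun w : Fin p → E × E => (w j).2) μ (stdGaussian E) :=
        measurePreserving_snd.comp
          (measurePreserving_eval (fun _ : Fin p => (ν n).prod (stdGaussian E)) j)
      rw [ENNReal.ofReal_add (by positivity) (by positivity)]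
      refine (measure_union_le {w : Fin p → E × E | δ ≤ |‖(w j).1‖ ^ 2 / a n - 1|}
        {w | δ ≤ |‖(w j).2‖ ^ 2 / n - 1|}).trans (add_le_add ?_ ?_)
      · have h := hconc n hn δ hδ0 hδρ
        rw [← e1.measureReal_preimage (measurableSet_le measurable_const
          (by fun_prop)).nullMeasurableSet] at h
        rw [← ofReal_measureReal]
        exact ENNReal.ofReal_le_ofReal h
      · have h := stdGaussian_norm_sq_tail hn hδ0
        rw [← e2.measureReal_preimage (measurableSet_le measurable_const
          (by fun_prop)).nullMeasurableSet] at h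
        rw [← ofReal_measureReal]
        exact ENNReal.ofReal_le_ofReal h
    have hms : MeasurableSet {z : (Fin (p - 1) → ℝ) × (Fin (p - 1) → ℝ) |
        ¬ ∀ i, z.2 i / κ ≤ z.1 i ∧ z.1 i ≤ κ * z.2 i} := by
      refine MeasurableSet.compl (MeasurableSet.congr (MeasurableSet.iInter fun i =>
        (measurableSet_le (f := fun z : (Fin (p - 1) → ℝ) × (Fin (p - 1) → ℝ) => z.2 i / κ)
          (g := fun z => z.1 i) (by fun_prop) (by fun_prop)).inter
        (measurableSet_le (f := fun z : (Fin (p - 1) → ℝ) × (Fin (p - 1) → ℝ) => z.1 i)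
          (g := fun z => κ * z.2 i) (by fun_prop) (by fun_prop))) ?_)
      ext z
      simp only [Set.mem_iInter]
      exact Iff.rfl
    rw [Measure.map_apply hpair hms]
    have hsub : (fun w : Fin p → E × E => (localRatio (fun j => transferNorm (w j)),
        localRatio fun j => (w j).2)) ⁻¹' {z | ¬ ∀ i, z.2 i / κ ≤ z.1 i ∧ z.1 i ≤ κ * z.2 i} ⊆
        ⋃ j, {w | δ ≤ |‖(w j).1‖ ^ 2 / a n - 1| ∨ δ ≤ |‖(w j).2‖ ^ 2 / n - 1|} := by
      intro w hw
      by_contra hcon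
      simp only [Set.mem_iUnion, Set.mem_ofPred_eq, not_exists, not_or, not_le] at hcon
      refine hw fun i => ?_
      have h := localRatio_transferNorm_mem hn hδ1 (fun j => (w j).1) (fun j => (w j).2)
        (fun j => (hcon j).1) (fun j => (hcon j).2) i
      have hr : 0 ≤ localRatio (fun j => (w j).2) i :=
        div_nonneg (gsNormSq_nonneg _ _) (gsNormSq_nonneg _ _)
      have hδ2 : 0 < 1 - δ := by linarith
      refine ⟨le_trans ?_ h.1, h.2.trans ?_⟩
      · exact div_le_div_of_nonneg_left hr (by positivity) hδκ.le
      · exact mul_le_mul_of_nonneg_right hδκ.le hr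
    refine (measure_mono hsub).trans ((measure_iUnion_le _).trans ?_)
    rw [tsum_fintype]
    refine (Finset.sum_le_sum fun j _ => hB j).trans ?_
    rw [Finset.sum_const, Finset.card_univ, Fintype.card_fin, nsmul_eq_mul,
      ← ENNReal.ofReal_natCast, ← ENNReal.ofReal_mul (by positivity)]
    refine ENNReal.ofReal_le_ofReal (le_trans ?_ hnε.le)
    have : (p : ℝ) ≤ n := by exact_mod_cast hp
    gcongr

/-- The norm with index `i` has shape `(n - i) / 2`, like `η (n - i)`; the index is written `n - 1 -
i + 1` to match the shift in `IsGammaSequence.indep`. The space carrying `η` does not depend on `n`,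
so almost sure limits become available. -/
lemma map_localRatio_stdGaussian {Ω' : Type*} [MeasurableSpace Ω'] {P' : Measure Ω'}
    [IsProbabilityMeasure P'] {η : ℕ → Ω' → ℝ} (hη : IsGammaSequence P' η) {n p : ℕ}
    (hp : p ≤ n) :
    (Measure.pi fun _ : Fin p => stdGaussian (EuclideanSpace ℝ (Fin n))).map localRatio =
      P'.map fun ω (i : Fin (p - 1)) => limitRatio η (n - 1 - i) ω := by
  have hm := measurePreserving_gsNormSq_stdGaussian hp
  have hlaw : ∀ i : Fin p, HasLaw (η (n - 1 - i + 1))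
      (gammaMeasure (((n - (i : ℕ) : ℕ) : ℝ) / 2) 1) P' := fun i => by
    have h := hη.hasLaw (n - 1 - i + 1) (by omega)
    rwa [show n - 1 - (i : ℕ) + 1 = n - i by omega] at h ⊢
  have hind : iIndepFun (fun i : Fin p => η (n - 1 - i + 1)) P' :=
    hη.indep.precomp (g := fun i : Fin p => n - 1 - (i : ℕ)) fun i j hij => by
      ext
      have : n - 1 - (i : ℕ) = n - 1 - j := hij
      omega
  have hpi := hind.hasLaw_pi hlaw
  let D : (Fin p → ℝ) → Fin (p - 1) → ℝ := fun y i => y ⟨i + 1, by omega⟩ / y ⟨i, by omega⟩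
  have hD : Measurable D := by fun_prop
  have h1 : localRatio = D ∘ fun (b : Fin p → EuclideanSpace ℝ (Fin n)) i => gsNormSq b i / 2 := by
    ext b i
    simp only [localRatio, D, Function.comp]
    rw [div_div_div_cancel_right₀ two_ne_zero]
  have h2 : (fun ω (i : Fin (p - 1)) => limitRatio η (n - 1 - i) ω) =
      D ∘ fun ω (i : Fin p) => η (n - 1 - i + 1) ω := by
    ext ω i
    simp only [limitRatio, D, Function.comp]
    congr 2
    omega
  rw [h1, h2, ← Measure.map_map hD hm.measurable, hm.map_eq,
    ← AEMeasurable.map_map_of_aemeasurable hD.aemeasurable hpi.aemeasurable, hpi.map_eq]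

lemma IsRandomBasis.map_localRatio {n p : ℕ} {Ω : Type*} [MeasurableSpace Ω] {P : Measure Ω}
    [IsProbabilityMeasure P] {ν : Measure (EuclideanSpace ℝ (Fin n))}
    {b : Fin p → Ω → EuclideanSpace ℝ (Fin n)} (hb : IsRandomBasis P ν b) :
    P.map (fun ω => localRatio fun i => b i ω) = (Measure.pi fun _ : Fin p => ν).map localRatio := by
  have h := hb.indep.hasLaw_pi hb.hasLaw
  rw [← h.map_eq, AEMeasurable.map_map_of_aemeasurable measurable_localRatio.aemeasurable
    h.aemeasurable]
  rfl

lemma IsRandomBasis.aemeasurable_localRatio {n p : ℕ} {Ω : Type*} [MeasurableSpace Ω]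
    {P : Measure Ω} {ν : Measure (EuclideanSpace ℝ (Fin n))}
    {b : Fin p → Ω → EuclideanSpace ℝ (Fin n)} (hb : IsRandomBasis P ν b) :
    AEMeasurable (fun ω => localRatio fun i => b i ω) P :=
  measurable_localRatio.comp_aemeasurable
    (aemeasurable_pi_lambda _ fun i => (hb.hasLaw i).aemeasurable)

/-! ### Almost sure behaviour of the limit ratios -/

lemma tendsto_limitRatio {Ω' : Type*} {η : ℕ → Ω' → ℝ} {ω : Ω'} (h : Tendsto (fun j : ℕ => η j ω / ((j : ℝ) / 2)) atTop (𝓝 1)) :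
    Tendsto (fun j => limitRatio η j ω) atTop (𝓝 1) := by
  have h1 := (h.div (h.comp (tendsto_add_atTop_nat 1)) one_ne_zero).mul
    (tendsto_natCast_div_add_atTop (1 : ℝ))
  simp only [div_one, mul_one] at h1
  refine h1.congr' ?_
  filter_upwards [eventually_gt_atTop 0] with j hj
  have : (0 : ℝ) < j := by exact_mod_cast hj
  simp only [limitRatio, Function.comp, Pi.div_apply]
  push_cast
  rcases eq_or_ne (η (j + 1) ω) 0 with h0 | h0
  · simp [h0]
  · field_simp

/-- Otherwise `η` would be nonincreasing from `k + 1` on, although it grows like `j / 2`. -/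
lemma exists_limitRatio_lt_one {Ω' : Type*} {η : ℕ → Ω' → ℝ} {ω : Ω'} (hpos : ∀ j, 1 ≤ j → 0 < η j ω)
    (h : Tendsto (fun j : ℕ => η j ω / ((j : ℝ) / 2)) atTop (𝓝 1)) (k : ℕ) :
    ∃ j, k + 1 ≤ j ∧ limitRatio η j ω < 1 := by
  by_contra! hcon
  have hanti : ∀ m, η (k + 1 + m) ω ≤ η (k + 1) ω := by
    intro m
    induction m with
    | zero => rfl
    | succ m ih =>
      have h1 := hcon (k + 1 + m) (by omega)
      rw [limitRatio, one_le_div (hpos _ (by omega))] at h1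
      exact h1.trans ih
  have h2 : Tendsto (fun j : ℕ => η j ω) atTop atTop := by
    have h3 : Tendsto (fun j : ℕ => (j : ℝ) / 2) atTop atTop :=
      tendsto_natCast_atTop_atTop.atTop_div_const two_pos
    refine (h.pos_mul_atTop one_pos h3).congr' ?_
    filter_upwards [eventually_gt_atTop 0] with j hj
    have : (0 : ℝ) < j := by exact_mod_cast hj
    field_simp
  obtain ⟨N, hN⟩ := eventually_atTop.1 (h2.eventually_gt_atTop (η (k + 1) ω))
  exact absurd (hanti N) (not_le.2 (hN (k + 1 + N) (by omega)))

section GammaSequence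

variable {Ω' : Type*} [MeasurableSpace Ω'] {P' : Measure Ω'} {η : ℕ → Ω' → ℝ}

lemma IsGammaSequence.aemeasurable_limitRatio (hη : IsGammaSequence P' η) {j : ℕ} (hj : 1 ≤ j) :
    AEMeasurable (limitRatio η j) P' :=
  (hη.hasLaw j hj).aemeasurable.div (hη.hasLaw (j + 1) (by omega)).aemeasurable

lemma IsGammaSequence.ae_pos (hη : IsGammaSequence P' η) :
    ∀ᵐ ω ∂P', ∀ j, 1 ≤ j → 0 < η j ω := by
  refine ae_all_iff.2 fun j => eventually_imp_distrib_left.2 fun hj => ?_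
  have h := ae_gammaMeasure_pos ((j : ℝ) / 2)
  rw [← (hη.hasLaw j hj).map_eq] at h
  exact ae_of_ae_map (hη.hasLaw j hj).aemeasurable h

/-- Borel-Cantelli for each precision `1 / (m + 1)`, the fourth moment tails being of order `1 /
j²`. -/
lemma IsGammaSequence.ae_tendsto_div [IsProbabilityMeasure P'] (hη : IsGammaSequence P' η) :
    ∀ᵐ ω ∂P', Tendsto (fun j : ℕ => η j ω / ((j : ℝ) / 2)) atTop (𝓝 1) := by
  have h : ∀ m : ℕ, ∀ᵐ ω ∂P', ∀ᶠ j : ℕ in atTop,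
      |η (j + 1) ω / (((j + 1 : ℕ) : ℝ) / 2) - 1| < 1 / ((m : ℝ) + 1) := by
    intro m
    have hδ : (0 : ℝ) < 1 / ((m : ℝ) + 1) := by positivity
    set δ : ℝ := 1 / ((m : ℝ) + 1)
    have hbd : ∀ j : ℕ, P' {ω | δ ≤ |η (j + 1) ω / (((j + 1 : ℕ) : ℝ) / 2) - 1|} ≤
        ENNReal.ofReal (60 / δ ^ 4 * (1 / ((j + 1 : ℕ) : ℝ) ^ 2)) := by
      intro j
      have hj : (1 : ℝ) ≤ ((j + 1 : ℕ) : ℝ) := by exact_mod_cast Nat.le_add_left 1 j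
      have ht := gammaMeasure_tail (a := ((j + 1 : ℕ) : ℝ) / 2) (by linarith) hδ
      rw [← (hη.hasLaw (j + 1) (by omega)).measureReal_eq
        (measurableSet_le measurable_const (by fun_prop))] at ht
      rw [← ofReal_measureReal]
      refine ENNReal.ofReal_le_ofReal (ht.trans (le_of_eq ?_))
      field_simp
      norm_num
    have hs : Summable fun j : ℕ => 60 / δ ^ 4 * (1 / ((j + 1 : ℕ) : ℝ) ^ 2) :=
      ((summable_nat_add_iff 1).2 (Real.summable_one_div_nat_pow.2 one_lt_two)).mul_left _
    have hfin : ∑' j : ℕ, P' {ω | δ ≤ |η (j + 1) ω / (((j + 1 : ℕ) : ℝ) / 2) - 1|} ≠ ⊤ := by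
      refine ne_top_of_le_ne_top ?_ (ENNReal.tsum_le_tsum hbd)
      exact hs.tsum_ofReal_ne_top
    filter_upwards [ae_eventually_notMem hfin] with ω hω
    filter_upwards [hω] with j hj
    simpa using hj
  filter_upwards [ae_all_iff.2 h] with ω hω
  rw [← tendsto_add_atTop_iff_nat 1, Metric.tendsto_atTop']
  intro ε hε
  obtain ⟨m, hm⟩ := exists_nat_one_div_lt hε
  obtain ⟨N, hN⟩ := eventually_atTop.1 (hω m)
  exact ⟨N, fun j hj => by rw [Real.dist_eq]; exact (hN j hj.le).trans hm⟩

/-- By Fubini the diagonal is null for a product law whose first factor has no atoms. -/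
lemma ae_ne_of_indepFun [IsProbabilityMeasure P'] {X Y : Ω' → ℝ} (hX : AEMeasurable X P') (hY : AEMeasurable Y P')
    (h : IndepFun X Y P') (hnull : ∀ x, P'.map X {x} = 0) : ∀ᵐ ω ∂P', X ω ≠ Y ω := by
  have hm := (indepFun_iff_map_prod_eq_prod_map_map hX hY).1 h
  have hd : MeasurableSet {z : ℝ × ℝ | z.1 = z.2} := measurableSet_eq_fun measurable_fst measurable_snd
  have : IsProbabilityMeasure (P'.map X) := Measure.isProbabilityMeasure_map hX
  have : IsProbabilityMeasure (P'.map Y) := Measure.isProbabilityMeasure_map hY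
  have h0 : P'.map (fun ω => (X ω, Y ω)) {z : ℝ × ℝ | z.1 = z.2} = 0 := by
    rw [hm, Measure.prod_apply_symm hd]
    refine lintegral_eq_zero_of_ae_eq_zero (ae_of_all _ fun y => ?_)
    exact hnull y
  rw [Measure.map_apply_of_aemeasurable (hX.prodMk hY) hd] at h0
  exact measure_eq_zero_iff_ae_notMem.1 h0

lemma IsGammaSequence.ae_limitRatio_ne [IsProbabilityMeasure P'] (hη : IsGammaSequence P' η) :
    ∀ᵐ ω ∂P', ∀ i j, 1 ≤ i → i < j → limitRatio η i ω ≠ limitRatio η j ω := by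
  refine ae_all_iff.2 fun i => ae_all_iff.2 fun j =>
    eventually_imp_distrib_left.2 fun hi => eventually_imp_distrib_left.2 fun hij => ?_
  obtain ⟨i, rfl⟩ : ∃ i', i = i' + 1 := ⟨i - 1, by omega⟩
  obtain ⟨j, rfl⟩ : ∃ j', j = j' + 1 := ⟨j - 1, by omega⟩
  have hmeas : ∀ l, AEMeasurable (η (l + 1)) P' := fun l =>
    (hη.hasLaw (l + 1) (by omega)).aemeasurable
  -- `R_i = R_j` would express `η_i` through `η_{i+1}`, `η_j`, `η_{j+1}`, all independent of `η_i`.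
  -- Adjacent indices, where `η_{i+1}` and `η_j` coincide, need no separate case.
  have hdisj : Disjoint ({i} : Finset ℕ) {i + 1, j, j + 1} := by
    rw [Finset.disjoint_singleton_left]
    simp; omega
  have hind := hη.indep.indepFun_finset₀ {i} {i + 1, j, j + 1} hdisj hmeas
  have hind2 : IndepFun (η (i + 1)) (fun ω => η (i + 1 + 1) ω * η (j + 1) ω / η (j + 1 + 1) ω) P' :=
    hind.comp (φ := fun v : ({i} : Finset ℕ) → ℝ => v ⟨i, by simp⟩)
      (ψ := fun v : ({i + 1, j, j + 1} : Finset ℕ) → ℝ =>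
        v ⟨i + 1, by simp⟩ * v ⟨j, by simp⟩ / v ⟨j + 1, by simp⟩)
      (by fun_prop) (by fun_prop)
  have hne := ae_ne_of_indepFun (hmeas i)
    (((hmeas (i + 1)).mul (hmeas j)).div (hmeas (j + 1))) hind2 (fun x => by
      rw [(hη.hasLaw (i + 1) (by omega)).map_eq]
      exact gammaMeasure_singleton _ x)
  filter_upwards [hne, hη.ae_pos] with ω hω hpos h
  have h1 := hpos (i + 1 + 1) (by omega)
  have h2 := hpos (j + 1 + 1) (by omega)
  rw [limitRatio, limitRatio, div_eq_div_iff h1.ne' h2.ne'] at h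
  refine hω ?_
  change _ = η (i + 1 + 1) ω * η (j + 1) ω / η (j + 1 + 1) ω
  rw [eq_div_iff h2.ne', h]
  ring

end GammaSequence

/-- A value below `1` confines the minimum to a finite window, since the tail stays above some `m <
1` exceeding that value. Inside the window the minimum is strict, so finitely many conditions on `κ`
near `1` suffice. -/
lemma exists_gap {R : ℕ → ℝ} {k : ℕ} (hR : Tendsto R atTop (𝓝 1)) (hpos : ∀ j, k + 1 ≤ j → 0 < R j)
    (hlt : ∃ j, k + 1 ≤ j ∧ R j < 1) (hne : ∀ i j, k + 1 ≤ i → i < j → R i ≠ R j) :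
    ∃ j, k + 1 ≤ j ∧ ∃ κ : ℝ, 1 < κ ∧ ∀ i, k + 1 ≤ i → i ≠ j → κ * R j ≤ R i := by
  obtain ⟨j₀, hj₀, hj₀1⟩ := hlt
  obtain ⟨m, hm1, hm2⟩ := exists_between hj₀1
  obtain ⟨N, hN⟩ := eventually_atTop.1 (hR.eventually_const_lt hm2)
  -- The endpoint `N + j₀` keeps `j₀` inside the window and puts everything outside it beyond `N`.
  obtain ⟨j, hj, hmin⟩ := (Finset.Icc (k + 1) (N + j₀)).exists_min_image R
    ⟨j₀, Finset.mem_Icc.2 ⟨hj₀, by omega⟩⟩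
  have hjk := (Finset.mem_Icc.1 hj).1
  have hjj₀ : R j ≤ R j₀ := hmin j₀ (Finset.mem_Icc.2 ⟨hj₀, by omega⟩)
  have hjp := hpos j hjk
  have hc : ∀ c, R j < c → ∀ᶠ κ in 𝓝[>] (1 : ℝ), κ * R j ≤ c := by
    intro c hc
    have h1 : Tendsto (fun κ : ℝ => κ * R j) (𝓝[>] 1) (𝓝 (1 * R j)) :=
      (tendsto_id.mul_const _).mono_left nhdsWithin_le_nhds
    rw [one_mul] at h1
    exact (h1.eventually_lt_const hc).mono fun _ h => h.le
  have hfin : ∀ᶠ κ in 𝓝[>] (1 : ℝ), ∀ i ∈ (Finset.Icc (k + 1) (N + j₀)).erase j,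
      κ * R j ≤ R i := by
    refine (Finset.eventually_all _).2 fun i hi => hc _ ?_
    obtain ⟨hij, hi⟩ := Finset.mem_erase.1 hi
    refine lt_of_le_of_ne (hmin i hi) ?_
    rcases lt_or_gt_of_ne hij with h | h
    · exact (hne i j (Finset.mem_Icc.1 hi).1 h).symm
    · exact hne j i hjk h
  obtain ⟨κ, ⟨h1, h2⟩, h3⟩ := ((hfin.and (hc m (hjj₀.trans_lt hm1))).and
    self_mem_nhdsWithin).exists
  refine ⟨j, hjk, κ, h3, fun i hi hij => ?_⟩
  by_cases hiN : i ≤ N + j₀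
  · exact h1 i (Finset.mem_erase.2 ⟨hij, Finset.mem_Icc.2 ⟨hi, hiN⟩⟩)
  · exact h2.trans (hN i (by omega)).le

lemma IsGammaSequence.ae_exists_gap {Ω' : Type*} [MeasurableSpace Ω'] {P' : Measure Ω'}
    [IsProbabilityMeasure P'] {η : ℕ → Ω' → ℝ} (hη : IsGammaSequence P' η) (k : ℕ) :
    ∀ᵐ ω ∂P', ∃ j, k + 1 ≤ j ∧ 0 < limitRatio η j ω ∧ ∃ κ : ℝ, 1 < κ ∧
      ∀ i, k + 1 ≤ i → i ≠ j → κ * limitRatio η j ω ≤ limitRatio η i ω := by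
  filter_upwards [hη.ae_pos, hη.ae_tendsto_div, hη.ae_limitRatio_ne] with ω hpos ht hne
  have hp : ∀ j, k + 1 ≤ j → 0 < limitRatio η j ω := fun j hj =>
    div_pos (hpos j (by omega)) (hpos (j + 1) (by omega))
  obtain ⟨j, hj, κ, hκ, h⟩ := exists_gap (R := fun j => limitRatio η j ω) (tendsto_limitRatio ht) hp
    (exists_limitRatio_lt_one hpos ht k) fun i j hi => hne i j (by omega)
  exact ⟨j, hj, hp j hj, κ, hκ, h⟩

/-! ### Stability of the minimum and of its index -/

section Deterministic

variable {Ω' : Type*} {η : ℕ → Ω' → ℝ} {ω : Ω'} {k j : ℕ}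

lemma limitLevel_eq (hj : k + 1 ≤ j)
    (h : ∀ i, k + 1 ≤ i → i ≠ j → limitRatio η j ω < limitRatio η i ω) :
    limitLevel η k ω = limitRatio η j ω := by
  have hle : ∀ i : {i : ℕ // k + 1 ≤ i}, limitRatio η j ω ≤ limitRatio η i ω := fun i => by
    rcases eq_or_ne (i : ℕ) j with hi | hi
    · rw [hi]
    · exact (h i i.2 hi).le
  have : Nonempty {i : ℕ // k + 1 ≤ i} := ⟨⟨j, hj⟩⟩
  exact le_antisymm (ciInf_le ⟨_, Set.forall_mem_range.2 hle⟩ (⟨j, hj⟩ : {i : ℕ // k + 1 ≤ i}))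
    (le_ciInf hle)

lemma eq_of_limitRatio_eq_limitLevel (hj : k + 1 ≤ j)
    (h : ∀ i, k + 1 ≤ i → i ≠ j → limitRatio η j ω < limitRatio η i ω) (i : ℕ) (hi : k + 1 ≤ i)
    (he : limitRatio η i ω = limitLevel η k ω) : i = j := by
  by_contra hne
  rw [limitLevel_eq hj h] at he
  exact (h i hi hne).ne' he

lemma limitIndex_eq (hj : k + 1 ≤ j)
    (h : ∀ i, k + 1 ≤ i → i ≠ j → limitRatio η j ω < limitRatio η i ω) :
    limitIndex η k ω = j := by
  have : {i : ℕ | k + 1 ≤ i ∧ limitRatio η i ω = limitLevel η k ω} = {j} := by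
    ext i
    refine ⟨fun hi => eq_of_limitRatio_eq_limitLevel hj h i hi.1 hi.2, ?_⟩
    rintro rfl
    exact ⟨hj, (limitLevel_eq hj h).symm⟩
  rw [limitIndex, this, csInf_singleton]

/-- The index of the minimum of a vector of consecutive ratios, in the numbering of
`worstIndex`. -/
noncomputable def minIndex (n : ℕ) {m : ℕ} (r : Fin m → ℝ) : ℕ :=
  sInf {j : ℕ | ∃ i : Fin m, j + ((i : ℕ) + 1) = n ∧ r i = ⨅ i, r i}

lemma iInf_eq_of_forall_lt {m : ℕ} {r : Fin m → ℝ} {i₀ : Fin m} (h : ∀ i, i ≠ i₀ → r i₀ < r i) :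
    ⨅ i, r i = r i₀ := by
  have : Nonempty (Fin m) := ⟨i₀⟩
  refine le_antisymm (ciInf_le (Finite.bddBelow_range r) i₀) (le_ciInf fun i => ?_)
  rcases eq_or_ne i i₀ with rfl | hi
  · rfl
  · exact (h i hi).le

lemma minIndex_eq {n m : ℕ} {r : Fin m → ℝ} {i₀ : Fin m} (h : ∀ i, i ≠ i₀ → r i₀ < r i)
    (hj : j + ((i₀ : ℕ) + 1) = n) : minIndex n r = j := by
  have : {j : ℕ | ∃ i : Fin m, j + ((i : ℕ) + 1) = n ∧ r i = ⨅ i, r i} = {j} := by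
    rw [iInf_eq_of_forall_lt h]
    ext l
    constructor
    · rintro ⟨i, hi, hr⟩
      have : i = i₀ := by
        by_contra hne
        exact (h i hne).ne' hr
      subst this
      simp only [Set.mem_singleton_iff]
      omega
    · rintro rfl
      exact ⟨i₀, hj, rfl⟩
  rw [minIndex, this, csInf_singleton]

lemma measurable_sInf_nat {α : Type*} [MeasurableSpace α] {p : ℕ → α → Prop}
    (hp : ∀ j, MeasurableSet {a | p j a}) : Measurable fun a => sInf {j | p j a} := by
  refine measurable_to_countable' fun l => ?_
  -- The second piece accounts for `sInf ∅ = 0`.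
  have h : (fun a => sInf {j | p j a}) ⁻¹' {l} =
      ({a | p l a} ∩ ⋂ i : {i // i < l}, {a | p i a}ᶜ) ∪
        ({_a | l = 0} ∩ ⋂ i, {a | p i a}ᶜ) := by
    ext a
    simp only [Set.mem_preimage, Set.mem_singleton_iff, Set.mem_union, Set.mem_inter_iff,
      Set.mem_iInter, Set.mem_compl_iff, Set.mem_ofPred_eq, Subtype.forall]
    constructor
    · rintro rfl
      rcases Set.eq_empty_or_nonempty {j | p j a} with h | h
      · refine Or.inr ⟨by rw [h, Nat.sInf_empty], fun i hi => ?_⟩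
        have : i ∈ {j | p j a} := hi
        rw [h] at this
        exact this
      · exact Or.inl ⟨Nat.sInf_mem h, fun i hi => Nat.notMem_of_lt_sInf hi⟩
    · rintro (⟨h1, h2⟩ | ⟨rfl, h2⟩)
      · refine le_antisymm (Nat.sInf_le h1) (not_lt.1 fun hlt => ?_)
        exact h2 _ hlt (Nat.sInf_mem (s := {j | p j a}) ⟨l, h1⟩)
      · have : {j | p j a} = ∅ := Set.eq_empty_of_forall_notMem h2
        rw [this, Nat.sInf_empty]
  rw [h]
  exact ((hp l).inter (MeasurableSet.iInter fun i : {i // i < l} => (hp i).compl)).union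
    ((MeasurableSet.const _).inter (MeasurableSet.iInter fun i => (hp i).compl))

lemma measurable_iInf_fin (m : ℕ) : Measurable fun r : Fin m → ℝ => ⨅ i, r i :=
  Measurable.iInf fun i => measurable_pi_apply i

lemma measurable_minIndex (n m : ℕ) : Measurable (minIndex n : (Fin m → ℝ) → ℕ) := by
  refine measurable_sInf_nat fun j => ?_
  have : {r : Fin m → ℝ | ∃ i : Fin m, j + ((i : ℕ) + 1) = n ∧ r i = ⨅ i, r i} =
      ⋃ i : Fin m, ({_r | j + ((i : ℕ) + 1) = n} ∩ {r | r i = ⨅ i, r i}) := by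
    ext r; simp
  rw [this]
  exact MeasurableSet.iUnion fun i => (MeasurableSet.const _).inter
    (measurableSet_eq_fun (measurable_pi_apply i) (measurable_iInf_fin m))

/-- Vectors with a minimum which is separated from the other entries by a factor `κ`. -/
def HasGap (κ : ℝ) {m : ℕ} (y : Fin m → ℝ) : Prop :=
  ∃ i₀, 0 < y i₀ ∧ ∀ i, i ≠ i₀ → κ * y i₀ ≤ y i

lemma measurableSet_hasGap (κ : ℝ) (m : ℕ) : MeasurableSet {y : Fin m → ℝ | HasGap κ y} := by
  have : {y : Fin m → ℝ | HasGap κ y} = ⋃ i₀ : Fin m, ({y | 0 < y i₀} ∩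
      ⋂ i : {i // i ≠ i₀}, {y | κ * y i₀ ≤ y i}) := by
    ext y; simp [HasGap]
  rw [this]
  exact MeasurableSet.iUnion fun i₀ => (measurableSet_lt (by fun_prop) (by fun_prop)).inter
    (MeasurableSet.iInter fun i => measurableSet_le (by fun_prop) (by fun_prop))

/-- The perturbation raises the minimum by at most `κ'` and divides the others by at most `κ'`, so a
gap larger than `κ' ^ 2` survives. -/
lemma minIndex_eq_of_hasGap {n m : ℕ} {κ κ' : ℝ} (hκ' : 1 < κ') (hκ : κ' ^ 2 < κ)
    {x y : Fin m → ℝ} (hm : m < n) (hgap : HasGap κ y)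
    (hxy : ∀ i, y i / κ' ≤ x i ∧ x i ≤ κ' * y i) : minIndex n x = minIndex n y := by
  obtain ⟨i₀, hy0, h⟩ := hgap
  have hκ1 : 1 < κ := by nlinarith
  have hκ0 : 0 < κ' := by linarith
  rw [minIndex_eq (j := n - (i₀ + 1)) (i₀ := i₀) (fun i hi => ?_) (by omega),
    minIndex_eq (j := n - (i₀ + 1)) (i₀ := i₀) (fun i hi => ?_) (by omega)]
  · have := h i hi
    nlinarith
  · have h1 := h i hi
    refine (hxy i₀).2.trans_lt (lt_of_lt_of_le ?_ (hxy i).1)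
    rw [lt_div_iff₀ hκ0]
    nlinarith [mul_lt_mul_of_pos_right hκ hy0]

lemma abs_iInf_sub_iInf_le {m : ℕ} {κ : ℝ} (hκ : 1 < κ) {x y : Fin m → ℝ}
    (hxy : ∀ i, y i / κ ≤ x i ∧ x i ≤ κ * y i) :
    |(⨅ i, x i) - ⨅ i, y i| ≤ (κ - 1) * ⨅ i, y i := by
  have hκ0 : 0 < κ := by linarith
  rcases isEmpty_or_nonempty (Fin m) with hm | hm
  · simp [Real.iInf_of_isEmpty]
  -- Nonnegativity is implicit: `y / κ ≤ κ * y` with `κ > 1` excludes `y < 0`.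
  have hy0 : ∀ i, 0 ≤ y i := fun i => by
    have h := (hxy i).1.trans (hxy i).2
    rw [div_le_iff₀ hκ0] at h
    by_contra! hneg
    have h1 : 0 < κ * κ - 1 := by nlinarith
    nlinarith [mul_neg_of_neg_of_pos hneg h1]
  have hi0 : 0 ≤ ⨅ i, y i := le_ciInf hy0
  have h1 : (⨅ i, y i) / κ ≤ ⨅ i, x i := le_ciInf fun i =>
    (div_le_div_of_nonneg_right (ciInf_le (Finite.bddBelow_range y) i) hκ0.le).trans (hxy i).1
  have h2 : ⨅ i, x i ≤ κ * ⨅ i, y i := by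
    obtain ⟨i, hi⟩ := exists_eq_ciInf_of_finite (f := y)
    rw [← hi]
    exact (ciInf_le (Finite.bddBelow_range x) i).trans (hxy i).2
  rw [div_le_iff₀ hκ0] at h1
  rw [abs_le]
  constructor <;> nlinarith

end Deterministic

/-! ### Convergence in distribution from couplings -/

section Coupling

variable {E : Type*} [MetricSpace E] [SecondCountableTopology E] [MeasurableSpace E]
  [BorelSpace E] {Ω' : Type*} [MeasurableSpace Ω'] {P' : Measure Ω'} [IsProbabilityMeasure P']

/-- Where the components are `ε`-close the Lipschitz bound costs `L * ε`; elsewhere the oscillation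
bound costs `|C|` times a probability at most `ε`. -/
lemma abs_integral_fst_sub_integral_snd_le {Q : Measure (E × E)} [IsProbabilityMeasure Q]
    {F : E → ℝ} {C : ℝ} (hC : ∀ x y, dist (F x) (F y) ≤ C) {L : NNReal} (hL : LipschitzWith L F)
    {ε : ℝ} (hε : 0 < ε) (hQ : Q {z | ε ≤ dist z.1 z.2} ≤ ENNReal.ofReal ε) :
    |∫ x, F x ∂(Q.map Prod.fst) - ∫ x, F x ∂(Q.map Prod.snd)| ≤ (L + |C|) * ε := by
  have hFm : Measurable F := hL.continuous.measurable
  obtain ⟨x₀⟩ : Nonempty E := by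
    by_contra h
    rw [not_nonempty_iff] at h
    have := measure_univ (μ := Q)
    rw [Set.univ_eq_empty_iff.2 inferInstance] at this
    simp at this
  have hbd : ∀ x, ‖F x‖ ≤ ‖F x₀‖ + C := fun x => by
    have := hC x x₀
    rw [dist_eq_norm] at this
    linarith [norm_sub_norm_le (F x) (F x₀)]
  have i1 : Integrable (fun z : E × E => F z.1) Q :=
    Integrable.of_bound (hFm.comp measurable_fst).aestronglyMeasurable _ (ae_of_all _ fun z => hbd z.1)
  have i2 : Integrable (fun z : E × E => F z.2) Q :=
    Integrable.of_bound (hFm.comp measurable_snd).aestronglyMeasurable _ (ae_of_all _ fun z => hbd z.2)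
  have hS : MeasurableSet {z : E × E | ε ≤ dist z.1 z.2} :=
    measurableSet_le measurable_const (by fun_prop)
  rw [integral_map (by fun_prop) hFm.aestronglyMeasurable,
    integral_map (by fun_prop) hFm.aestronglyMeasurable, ← integral_sub i1 i2, ← Real.norm_eq_abs]
  refine (norm_integral_le_integral_norm _).trans ?_
  have i3 : Integrable ({z : E × E | ε ≤ dist z.1 z.2}.indicator fun _ => |C|) Q :=
    (integrable_const _).indicator hS
  have hpt : ∀ z : E × E, ‖F z.1 - F z.2‖ ≤
      L * ε + {z : E × E | ε ≤ dist z.1 z.2}.indicator (fun _ => |C|) z := by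
    intro z
    by_cases hz : ε ≤ dist z.1 z.2
    · rw [Set.indicator_of_mem (by exact hz), ← dist_eq_norm]
      have h1 := (hC z.1 z.2).trans (le_abs_self C)
      have h2 : 0 ≤ (L : ℝ) * ε := by positivity
      linarith
    · rw [Set.indicator_of_notMem (by exact hz), add_zero, ← dist_eq_norm]
      exact (hL.dist_le_mul _ _).trans (by gcongr; exact (not_le.1 hz).le)
  refine (integral_mono (i1.sub i2).norm ((integrable_const _).add i3) hpt).trans ?_
  rw [integral_add' (integrable_const _) i3, integral_indicator hS]
  simp only [integral_const, probReal_univ, smul_eq_mul, one_mul, measureReal_restrict_apply,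
    MeasurableSet.univ, Set.univ_inter]
  have hq : Q.real {z : E × E | ε ≤ dist z.1 z.2} ≤ ε := by
    rw [measureReal_def]
    exact ENNReal.toReal_le_of_le_ofReal hε.le hQ
  nlinarith [mul_le_mul_of_nonneg_right hq (abs_nonneg C)]

/-- If `W n → Z` almost surely and the law of `X n` can be coupled with the law of `W n` such that
the two components are close with high probability, then `X n → Z` in distribution. -/
theorem tendstoInDistribution_of_coupling {Ω : ℕ → Type*} [∀ n, MeasurableSpace (Ω n)]
    {P : ∀ n, Measure (Ω n)} [∀ n, IsProbabilityMeasure (P n)] {X : ∀ n, Ω n → E}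
    {W : ℕ → Ω' → E} {Z : Ω' → E} (hX : ∀ n, AEMeasurable (X n) (P n))
    (hW : ∀ n, AEMeasurable (W n) P')
    (hWZ : ∀ᵐ ω ∂P', Tendsto (fun n => W n ω) atTop (𝓝 (Z ω)))
    (hQ : ∀ ε : ℝ, 0 < ε → ∀ᶠ n in atTop, ∃ Q : Measure (E × E),
      Q.map Prod.fst = (P n).map (X n) ∧ Q.map Prod.snd = P'.map (W n) ∧
      Q {z | ε ≤ dist z.1 z.2} ≤ ENNReal.ofReal ε) :
    TendstoInDistribution X atTop Z P P' := by
  have hZ : AEMeasurable Z P' := aemeasurable_of_tendsto_metrizable_ae _ hW hWZ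
  refine ⟨hX, hZ, ?_⟩
  have hWd := (tendstoInDistribution_of_ae_tendsto hW hZ hWZ).tendsto
  refine tendsto_iff_forall_lipschitz_integral_tendsto.2 ?_
  rintro F ⟨C, hC⟩ ⟨L, hL⟩
  have h1 := tendsto_iff_forall_lipschitz_integral_tendsto.1 hWd F ⟨C, hC⟩ ⟨L, hL⟩
  simp only [ProbabilityMeasure.coe_mk] at h1 ⊢
  have h2 : Tendsto (fun n => ∫ x, F x ∂((P n).map (X n)) - ∫ x, F x ∂(P'.map (W n)))
      atTop (𝓝 0) := by
    rw [Metric.tendsto_nhds]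
    intro e he
    have hD : 0 < (L : ℝ) + |C| + 1 := by positivity
    filter_upwards [hQ (e / (L + |C| + 1)) (by positivity)] with n ⟨Q, hQ1, hQ2, hQ3⟩
    have : IsProbabilityMeasure (P'.map (W n)) := Measure.isProbabilityMeasure_map (hW n)
    have : IsProbabilityMeasure Q := by
      rw [← hQ2, Measure.isProbabilityMeasure_map_iff (by fun_prop)] at this
      exact this
    have hb := abs_integral_fst_sub_integral_snd_le hC hL (by positivity) hQ3
    rw [hQ1, hQ2] at hb
    rw [Real.dist_eq, sub_zero]
    refine hb.trans_lt ?_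
    rw [mul_div_assoc', div_lt_iff₀ hD]
    nlinarith
  simpa using h2.add h1

end Coupling

/-! ### Windows of the limit process -/

section LimitVector

variable {Ω' : Type*} {η : ℕ → Ω' → ℝ}

/-- The limit ratios, in the order of the consecutive ratios of a system of `p` vectors. -/
noncomputable def limitVector (η : ℕ → Ω' → ℝ) (n p : ℕ) (ω : Ω') (i : Fin (p - 1)) : ℝ :=
  limitRatio η (n - 1 - i) ω

lemma limitVector_apply {n k j : ℕ} (hj : k + 1 ≤ j) (hjn : j < n) (ω : Ω') :
    limitVector η n (n - k) ω ⟨n - 1 - j, by omega⟩ = limitRatio η j ω := by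
  simp only [limitVector]
  congr 1
  omega

/-- The predicate is left abstract to serve both strict inequalities and gaps by a factor. -/
lemma limitVector_lt {n k j : ℕ} (hj : k + 1 ≤ j) (hjn : j < n) {ω : Ω'} {p : ℝ → Prop}
    (h : ∀ i, k + 1 ≤ i → i ≠ j → p (limitRatio η i ω)) (i : Fin (n - k - 1))
    (hi : i ≠ ⟨n - 1 - j, by omega⟩) : p (limitVector η n (n - k) ω i) := by
  refine h _ (by omega) fun he => hi ?_
  ext
  simp only
  omega

lemma IsGammaSequence.aemeasurable_limitVector [MeasurableSpace Ω'] {P' : Measure Ω'}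
    (hη : IsGammaSequence P' η) {n p : ℕ} (hp : p ≤ n) :
    AEMeasurable (limitVector η n p) P' :=
  aemeasurable_pi_lambda _ fun i => hη.aemeasurable_limitRatio (by omega)

end LimitVector

/-! ### The three limit theorems -/

section Main

variable {Ω' : Type*} [MeasurableSpace Ω'] {P' : Measure Ω'} [IsProbabilityMeasure P']
  {η : ℕ → Ω' → ℝ}

/-- Criterion for convergence in distribution of functionals of the consecutive ratios. -/
theorem tendstoInDistribution_of_localRatio {E : Type*} [MetricSpace E]
    [SecondCountableTopology E] [MeasurableSpace E] [BorelSpace E]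
    {ν : ∀ n : ℕ, Measure (EuclideanSpace ℝ (Fin n))}
    (hν : IsSpherical ν) (hconc : RadialConcentration ν)
    {Ω : ℕ → Type*} [∀ n, MeasurableSpace (Ω n)]
    {P : ∀ n, Measure (Ω n)} [∀ n, IsProbabilityMeasure (P n)]
    (hη : IsGammaSequence P' η) {k : ℕ} {b : ∀ n : ℕ, Fin (n - k) → Ω n → EuclideanSpace ℝ (Fin n)}
    (hb : ∀ n, IsRandomBasis (P n) (ν n) (b n)) {f : ∀ n : ℕ, (Fin (n - k - 1) → ℝ) → E}
    (hf : ∀ n, Measurable (f n)) {Z : Ω' → E}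
    (hZ : ∀ᵐ ω ∂P', Tendsto (fun n => f n (limitVector η n (n - k) ω)) atTop (𝓝 (Z ω)))
    (hclose : ∀ ε : ℝ, 0 < ε → ∃ κ : ℝ, 1 < κ ∧ ∀ᶠ n in atTop, ∃ S : Set (Fin (n - k - 1) → ℝ),
      MeasurableSet S ∧ P' {ω | limitVector η n (n - k) ω ∈ S} ≤ ENNReal.ofReal ε ∧
      ∀ x y, (∀ i, y i / κ ≤ x i ∧ x i ≤ κ * y i) → y ∉ S → dist (f n x) (f n y) < ε) :
    TendstoInDistribution (fun n ω => f n (localRatio fun i => b n i ω)) atTop Z P P' := by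
  have hT : ∀ n, AEMeasurable (limitVector η n (n - k)) P' := fun n =>
    hη.aemeasurable_limitVector (Nat.sub_le n k)
  refine tendstoInDistribution_of_coupling
    (fun n => (hf n).comp_aemeasurable (hb n).aemeasurable_localRatio)
    (fun n => (hf n).comp_aemeasurable (hT n)) hZ fun ε hε => ?_
  -- Half of `ε` goes to the exceptional set `S`, half to failure of the coupling.
  obtain ⟨κ, hκ, hS⟩ := hclose (ε / 2) (by positivity)
  filter_upwards [hS, exists_ratio_coupling ν hν hconc hκ (half_pos hε)]
    with n ⟨S, hSm, hSP, hSd⟩ hQ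
  obtain ⟨Q, hQ1, hQ2, hQ3⟩ := hQ (n - k) (Nat.sub_le n k)
  rw [← (hb n).map_localRatio] at hQ1
  rw [map_localRatio_stdGaussian hη (Nat.sub_le n k)] at hQ2
  have hff : Measurable (Prod.map (f n) (f n)) := (hf n).prodMap (hf n)
  refine ⟨Q.map (Prod.map (f n) (f n)), ?_, ?_, ?_⟩
  · rw [Measure.map_map measurable_fst hff, show Prod.fst ∘ Prod.map (f n) (f n) = f n ∘ Prod.fst
      from rfl, ← Measure.map_map (hf n) measurable_fst, hQ1,
      AEMeasurable.map_map_of_aemeasurable (hf n).aemeasurable (hb n).aemeasurable_localRatio]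
    rfl
  · rw [Measure.map_map measurable_snd hff, show Prod.snd ∘ Prod.map (f n) (f n) = f n ∘ Prod.snd
      from rfl, ← Measure.map_map (hf n) measurable_snd, hQ2]
    exact AEMeasurable.map_map_of_aemeasurable (hf n).aemeasurable (hT n)
  · rw [Measure.map_apply hff (measurableSet_le measurable_const (by fun_prop))]
    have hsub : Prod.map (f n) (f n) ⁻¹' {z : E × E | ε ≤ dist z.1 z.2} ⊆
        {z | ¬ ∀ i, z.2 i / κ ≤ z.1 i ∧ z.1 i ≤ κ * z.2 i} ∪ Prod.snd ⁻¹' S := by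
      intro z hz
      by_contra hcon
      rw [Set.mem_union, not_or] at hcon
      have h1 := hSd z.1 z.2 (not_not.1 hcon.1) hcon.2
      have h2 : ε ≤ dist (f n z.1) (f n z.2) := hz
      linarith
    have hS2 : Q (Prod.snd ⁻¹' S) ≤ ENNReal.ofReal (ε / 2) := by
      rw [← Measure.map_apply measurable_snd hSm, hQ2]
      refine le_trans (le_of_eq ?_) hSP
      exact Measure.map_apply_of_aemeasurable (hT n) hSm
    refine (measure_mono hsub).trans ((measure_union_le _ _).trans ((add_le_add hQ3 hS2).trans ?_))
    rw [← ENNReal.ofReal_add (by positivity) (by positivity), add_halves]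

/-- Along the limit process the windowed minimum is almost surely eventually constant, once the
window contains the minimiser. Multiplicative closeness gives additive closeness where the minimum
is bounded, and it is bounded by the single tight variable `limitRatio η (k + 1)`. -/
theorem tendstoInDistribution_reductionLevel
    {ν : ∀ n : ℕ, Measure (EuclideanSpace ℝ (Fin n))}
    (hν : IsSpherical ν) (hconc : RadialConcentration ν)
    {Ω : ℕ → Type*} [∀ n, MeasurableSpace (Ω n)]
    {P : ∀ n, Measure (Ω n)} [∀ n, IsProbabilityMeasure (P n)]
    (hη : IsGammaSequence P' η) {k : ℕ} {b : ∀ n : ℕ, Fin (n - k) → Ω n → EuclideanSpace ℝ (Fin n)}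
    (hb : ∀ n, IsRandomBasis (P n) (ν n) (b n)) :
    TendstoInDistribution (fun n ω => reductionLevel fun i => b n i ω) atTop
      (limitLevel η k) P P' := by
  refine tendstoInDistribution_of_localRatio hν hconc hη hb (f := fun n r => ⨅ i, r i)
    (fun n => measurable_iInf_fin _) ?_ fun ε hε => ?_
  · filter_upwards [hη.ae_exists_gap k] with ω ⟨j, hj, hpos, κ, hκ, h⟩
    have hlt : ∀ i, k + 1 ≤ i → i ≠ j → limitRatio η j ω < limitRatio η i ω := fun i hi hij => by
      nlinarith [h i hi hij]
    rw [limitLevel_eq hj hlt]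
    refine tendsto_const_nhds.congr' ?_
    filter_upwards [eventually_gt_atTop j] with n hn
    rw [← limitVector_apply hj hn]
    exact (iInf_eq_of_forall_lt fun i hi => by
      rw [limitVector_apply hj hn]
      exact limitVector_lt hj hn hlt i hi).symm
  · have hR := hη.aemeasurable_limitRatio (j := k + 1) (by omega)
    obtain ⟨K, hK0, hK⟩ : ∃ K : ℝ, 0 < K ∧
        P' {ω | K < limitRatio η (k + 1) ω} ≤ ENNReal.ofReal ε := by
      have ht : Tendsto (fun K : ℝ => P'.map (limitRatio η (k + 1)) (Set.Ioi K)) atTop (𝓝 0) := by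
        have hP := Measure.isProbabilityMeasure_map hR
        have h0 : ⋂ K : ℝ, Set.Ioi K = ∅ :=
          Set.eq_empty_of_forall_notMem fun x hx => lt_irrefl x (Set.mem_iInter.1 hx x)
        have h := tendsto_measure_iInter_atTop (μ := P'.map (limitRatio η (k + 1)))
          (s := fun K : ℝ => Set.Ioi K) (fun K => measurableSet_Ioi.nullMeasurableSet)
          (fun _ _ h => Set.Ioi_subset_Ioi h) ⟨0, measure_ne_top _ _⟩
        rwa [h0, measure_empty] at h
      obtain ⟨K, hK1, hK2⟩ := ((ht.eventually_le_const (ENNReal.ofReal_pos.2 hε)).and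
        (eventually_gt_atTop 0)).exists
      rw [Measure.map_apply_of_aemeasurable hR measurableSet_Ioi] at hK1
      exact ⟨K, hK2, hK1⟩
    have hε2 : 0 < ε / (2 * K) := by positivity
    refine ⟨1 + ε / (2 * K), by linarith, ?_⟩
    filter_upwards [eventually_gt_atTop (k + 1)] with n hn
    refine ⟨{y | K < ⨅ i, y i}, measurableSet_lt measurable_const (measurable_iInf_fin _), ?_, ?_⟩
    · refine le_trans (measure_mono fun ω hω => ?_) hK
      have h1 : K < ⨅ i, limitVector η n (n - k) ω i := hω
      have h2 := ciInf_le (Finite.bddBelow_range (limitVector η n (n - k) ω))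
        ⟨n - 1 - (k + 1), by omega⟩
      rw [limitVector_apply le_rfl hn] at h2
      exact h1.trans_le h2
    · intro x y hxy hy
      have hy : ⨅ i, y i ≤ K := not_lt.1 hy
      have h := abs_iInf_sub_iInf_le (by linarith) hxy
      rw [Real.dist_eq]
      refine h.trans_lt ?_
      rw [add_sub_cancel_left]
      calc ε / (2 * K) * ⨅ i, y i ≤ ε / (2 * K) * K := by gcongr
        _ = ε / 2 := by field_simp
        _ < ε := by linarith

theorem tendsto_measure_reductionLevel_sub_one
    {ν : ∀ n : ℕ, Measure (EuclideanSpace ℝ (Fin n))}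
    (hν : IsSpherical ν) (hconc : RadialConcentration ν)
    {Ω : ℕ → Type*} [∀ n, MeasurableSpace (Ω n)]
    {P : ∀ n, Measure (Ω n)} [∀ n, IsProbabilityMeasure (P n)]
    (hη : IsGammaSequence P' η) {g : ℕ → ℕ}
    {b : ∀ n : ℕ, Fin (n - g n) → Ω n → EuclideanSpace ℝ (Fin n)}
    (hg : ∀ᶠ n in atTop, g n + 2 ≤ n) (hg' : Tendsto g atTop atTop)
    (hb : ∀ n, IsRandomBasis (P n) (ν n) (b n)) {ε : ℝ} (hε : 0 < ε) :
    Tendsto (fun n => P n {ω | ε ≤ |reductionLevel (fun i => b n i ω) - 1|}) atTop (𝓝 0) := by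
  have hT : ∀ n, AEMeasurable (limitVector η n (n - g n)) P' := fun n =>
    hη.aemeasurable_limitVector (Nat.sub_le n (g n))
  have hW : ∀ᵐ ω ∂P', Tendsto (fun n => ⨅ i, limitVector η n (n - g n) ω i) atTop (𝓝 1) := by
    filter_upwards [hη.ae_tendsto_div] with ω hω
    rw [Metric.tendsto_atTop']
    intro e he
    obtain ⟨N, hN⟩ := Metric.tendsto_atTop.1 (tendsto_limitRatio hω) (e / 2) (by positivity)
    obtain ⟨N', hN'⟩ := eventually_atTop.1 (hg.and (hg'.eventually_ge_atTop N))
    refine ⟨N', fun n hn => ?_⟩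
    obtain ⟨h1, h2⟩ := hN' n hn.le
    have hd : ∀ i, |limitVector η n (n - g n) ω i - 1| < e / 2 := fun i =>
      hN _ (by have := i.2; omega)
    have : Nonempty (Fin (n - g n - 1)) := ⟨⟨0, by omega⟩⟩
    obtain ⟨i, hi⟩ := exists_eq_ciInf_of_finite (f := limitVector η n (n - g n) ω)
    rw [← hi, Real.dist_eq]
    exact (hd i).trans (by linarith)
  have hWm := tendstoInMeasure_of_tendsto_ae (μ := P') (fun n =>
    ((measurable_iInf_fin _).comp_aemeasurable (hT n)).aestronglyMeasurable) hW
  rw [tendstoInMeasure_iff_dist] at hWm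
  -- The cap `1` keeps the Gaussian minimum below `2`, so the coupling error is at most `(ε / 4) *
  -- 2`; with the deviation `ε / 4` the total stays below `ε`.
  set e := min (ε / 4) 1
  have he0 : 0 < e := by positivity
  have hWe := hWm e he0
  rw [ENNReal.tendsto_nhds_zero] at hWe ⊢
  intro t ht
  obtain ⟨s, hs0, hst⟩ : ∃ s : ℝ, 0 < s ∧ ENNReal.ofReal s ≤ t / 2 := by
    obtain ⟨r, hr0, hr⟩ := ENNReal.lt_iff_exists_nnreal_btwn.1 (ENNReal.half_pos ht.ne')
    exact ⟨r, by exact_mod_cast hr0, by rw [ENNReal.ofReal_coe_nnreal]; exact hr.le⟩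
  filter_upwards [hWe (ENNReal.ofReal s) (ENNReal.ofReal_pos.2 hs0),
    exists_ratio_coupling ν hν hconc (κ := 1 + ε / 4) (by linarith) hs0] with n hn hQ
  obtain ⟨Q, hQ1, hQ2, hQ3⟩ := hQ (n - g n) (Nat.sub_le _ _)
  rw [← (hb n).map_localRatio] at hQ1
  rw [map_localRatio_stdGaussian hη (Nat.sub_le _ _)] at hQ2
  have hm := measurable_iInf_fin (n - g n - 1)
  have hA : MeasurableSet {x : Fin (n - g n - 1) → ℝ | ε ≤ |(⨅ i, x i) - 1|} :=
    measurableSet_le measurable_const (hm.sub_const 1).abs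
  have hB : MeasurableSet {x : Fin (n - g n - 1) → ℝ | e ≤ dist (⨅ i, x i) 1} :=
    measurableSet_le measurable_const (hm.dist measurable_const)
  have e1 : P n {ω | ε ≤ |reductionLevel (fun i => b n i ω) - 1|} =
      Q (Prod.fst ⁻¹' {x | ε ≤ |(⨅ i, x i) - 1|}) := by
    rw [← Measure.map_apply measurable_fst hA, hQ1,
      Measure.map_apply_of_aemeasurable (hb n).aemeasurable_localRatio hA]
    rfl
  have e2 : Q (Prod.snd ⁻¹' {x | e ≤ dist (⨅ i, x i) 1}) ≤ ENNReal.ofReal s := by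
    rw [← Measure.map_apply measurable_snd hB, hQ2]
    refine le_trans (le_of_eq ?_) hn
    exact Measure.map_apply_of_aemeasurable (hT n) hB
  rw [e1]
  have hsub : Prod.fst ⁻¹' {x : Fin (n - g n - 1) → ℝ | ε ≤ |(⨅ i, x i) - 1|} ⊆
      {z : (Fin (n - g n - 1) → ℝ) × (Fin (n - g n - 1) → ℝ) |
        ¬ ∀ i, z.2 i / (1 + ε / 4) ≤ z.1 i ∧ z.1 i ≤ (1 + ε / 4) * z.2 i} ∪
        Prod.snd ⁻¹' {x : Fin (n - g n - 1) → ℝ | e ≤ dist (⨅ i, x i) 1} := by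
    intro z hz
    by_contra hcon
    rw [Set.mem_union, not_or] at hcon
    have h1 := abs_iInf_sub_iInf_le (by linarith) (not_not.1 hcon.1)
    have h2 : |(⨅ i, z.2 i) - 1| < e := not_le.1 hcon.2
    have h3 : ε ≤ |(⨅ i, z.1 i) - 1| := hz
    have h4 : |(⨅ i, z.2 i) - 1| < ε / 4 := h2.trans_le (min_le_left _ _)
    have h5 := (abs_lt.1 (h2.trans_le (min_le_right _ _))).2
    have h6 := abs_sub_le (⨅ i, z.1 i) (⨅ i, z.2 i) 1
    nlinarith
  refine (measure_mono hsub).trans ((measure_union_le _ _).trans ((add_le_add hQ3 e2).trans ?_))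
  exact (add_le_add hst hst).trans (ENNReal.add_halves t).le

/-- Continuity from above turns the almost sure gap into a quantitative one. Window and gap size are
tied to one parameter `N`, so that the bad events decrease to a null set; `t = 1 / (N + 2)` is below
`1` even for `N = 0`. The form `1 + 4 * t` exceeds `(1 + t) ^ 2`, as `minIndex_eq_of_hasGap`
requires. -/
lemma IsGammaSequence.exists_gap_whp (hη : IsGammaSequence P' η) (k : ℕ) {ε : ℝ} (hε : 0 < ε) :
    ∃ (N : ℕ) (t : ℝ), 0 < t ∧ t < 1 ∧ P' {ω | ¬ ∃ j < N, 0 < limitRatio η (k + 1 + j) ω ∧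
      ∀ i, i ≠ j → (1 + 4 * t) * limitRatio η (k + 1 + j) ω ≤ limitRatio η (k + 1 + i) ω} ≤
        ENNReal.ofReal ε := by
  let B : ℕ → Set Ω' := fun N => {ω | ¬ ∃ j < N, 0 < limitRatio η (k + 1 + j) ω ∧
    ∀ i, i ≠ j → (1 + 4 * (1 / ((N : ℝ) + 2))) * limitRatio η (k + 1 + j) ω ≤
      limitRatio η (k + 1 + i) ω}
  have hmeas : ∀ j, AEMeasurable (limitRatio η (k + 1 + j)) P' := fun j =>
    hη.aemeasurable_limitRatio (by omega)
  have hnull : ∀ N, NullMeasurableSet (B N) P' := by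
    intro N
    have : B N = (⋃ j : {j // j < N}, ({ω | 0 < limitRatio η (k + 1 + j) ω} ∩
        ⋂ i : {i // i ≠ (j : ℕ)}, {ω | (1 + 4 * (1 / ((N : ℝ) + 2))) *
          limitRatio η (k + 1 + j) ω ≤ limitRatio η (k + 1 + i) ω}))ᶜ := by
      ext ω
      simp [B]
    rw [this]
    exact (NullMeasurableSet.iUnion fun j : {j // j < N} => (nullMeasurableSet_lt aemeasurable_const
      (hmeas j)).inter (NullMeasurableSet.iInter fun i : {i // i ≠ (j : ℕ)} =>
        nullMeasurableSet_le ((hmeas j).const_mul _) (hmeas i))).compl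
  have hanti : Antitone B := by
    intro N N' hNN' ω hω ⟨j, hjN, hpos, h⟩
    refine hω ⟨j, by omega, hpos, fun i hi => le_trans ?_ (h i hi)⟩
    gcongr
  have hlim := tendsto_measure_iInter_atTop hnull hanti ⟨0, measure_ne_top _ _⟩
  have hzero : P' (⋂ N, B N) = 0 := by
    rw [measure_eq_zero_iff_ae_notMem]
    filter_upwards [hη.ae_exists_gap k] with ω ⟨j, hj, hpos, κ, hκ, h⟩ hω
    obtain ⟨m, hm⟩ := exists_nat_one_div_lt (show 0 < (κ - 1) / 4 by linarith)
    obtain ⟨j, rfl⟩ := Nat.exists_eq_add_of_le hj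
    -- This `N` exceeds `j` and is large enough that `4 / (N + 2) ≤ κ - 1`.
    refine Set.mem_iInter.1 hω (m + j + 1) ⟨j, by omega, hpos, fun i hi => ?_⟩
    refine le_trans ?_ (h (k + 1 + i) (by omega) (by omega))
    have h1 : 1 / (((m + j + 1 : ℕ) : ℝ) + 2) ≤ 1 / ((m : ℝ) + 1) := by
      refine one_div_le_one_div_of_le (by positivity) ?_
      push_cast
      have : (0 : ℝ) ≤ j := by positivity
      linarith
    exact mul_le_mul_of_nonneg_right (by linarith) hpos.le
  rw [hzero] at hlim
  obtain ⟨N, hN⟩ := (hlim.eventually_le_const (ENNReal.ofReal_pos.2 hε)).exists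
  refine ⟨N, 1 / ((N : ℝ) + 2), by positivity, ?_, hN⟩
  rw [div_lt_one (by positivity)]
  have : (0 : ℝ) ≤ N := by positivity
  linarith

theorem tendstoInDistribution_worstIndex
    {ν : ∀ n : ℕ, Measure (EuclideanSpace ℝ (Fin n))}
    (hν : IsSpherical ν) (hconc : RadialConcentration ν)
    {Ω : ℕ → Type*} [∀ n, MeasurableSpace (Ω n)]
    {P : ∀ n, Measure (Ω n)} [∀ n, IsProbabilityMeasure (P n)]
    (hη : IsGammaSequence P' η) {k : ℕ} {b : ∀ n : ℕ, Fin (n - k) → Ω n → EuclideanSpace ℝ (Fin n)}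
    (hb : ∀ n, IsRandomBasis (P n) (ν n) (b n)) :
    TendstoInDistribution (fun n ω => worstIndex fun i => b n i ω) atTop
      (limitIndex η k) P P' := by
  -- `worstIndex` unfolds to `minIndex n` of the vector of ratios.
  refine tendstoInDistribution_of_localRatio hν hconc hη hb (f := fun n r => minIndex n r)
    (fun n => measurable_minIndex n _) ?_ fun ε hε => ?_
  · filter_upwards [hη.ae_exists_gap k] with ω ⟨j, hj, hpos, κ, hκ, h⟩
    have hlt : ∀ i, k + 1 ≤ i → i ≠ j → limitRatio η j ω < limitRatio η i ω := fun i hi hij => by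
      nlinarith [h i hi hij]
    rw [limitIndex_eq hj hlt]
    refine tendsto_const_nhds.congr' ?_
    filter_upwards [eventually_gt_atTop j] with n hn
    refine (minIndex_eq (i₀ := ⟨n - 1 - j, by omega⟩) (fun i hi => ?_) ?_).symm
    · rw [limitVector_apply hj hn]
      exact limitVector_lt hj hn hlt i hi
    · simp only
      omega
  · obtain ⟨N, t, ht0, ht1, hN⟩ := hη.exists_gap_whp k hε
    refine ⟨1 + t, by linarith, ?_⟩
    filter_upwards [eventually_ge_atTop (N + k + 2)] with n hn
    refine ⟨{y | ¬ HasGap (1 + 4 * t) y}, (measurableSet_hasGap _ _).compl, ?_, ?_⟩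
    · refine le_trans (measure_mono fun ω hω => ?_) hN
      rintro ⟨j, hjN, hpos, h⟩
      have hj : k + 1 ≤ k + 1 + j := by omega
      have hjn : k + 1 + j < n := by omega
      refine hω ⟨⟨n - 1 - (k + 1 + j), by omega⟩, ?_, fun i hi => ?_⟩
      · rwa [limitVector_apply hj hjn]
      · rw [limitVector_apply hj hjn]
        refine limitVector_lt hj hjn (p := fun x => _ ≤ x) (fun i hi hij => ?_) i hi
        obtain ⟨i, rfl⟩ := Nat.exists_eq_add_of_le hi
        exact h i (by omega)
    · intro x y hxy hy
      rw [minIndex_eq_of_hasGap (by linarith) (by nlinarith) (by omega) (not_not.1 hy) hxy,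
        dist_self]
      exact hε

end Main

end RandomBasis

theorem theorem1p8
    (ν : ∀ n : ℕ, Measure (EuclideanSpace ℝ (Fin n)))
    (hν : RandomBasis.IsSpherical ν) (hconc : RandomBasis.RadialConcentration ν)
    {Ω : ℕ → Type*} [∀ n, MeasurableSpace (Ω n)]
    (P : ∀ n, Measure (Ω n)) [∀ n, IsProbabilityMeasure (P n)]
    {Ω' : Type*} [MeasurableSpace Ω'] (P' : Measure Ω') [IsProbabilityMeasure P']
    (η : ℕ → Ω' → ℝ) (hη : RandomBasis.IsGammaSequence P' η) :
    (∀ (k : ℕ) (b : ∀ n : ℕ, Fin (n - k) → Ω n → EuclideanSpace ℝ (Fin n)),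
      (∀ n, RandomBasis.IsRandomBasis (P n) (ν n) (b n)) →
      TendstoInDistribution (fun n ω => RandomBasis.reductionLevel (fun i => b n i ω)) atTop
        (RandomBasis.limitLevel η k) P P') ∧
    (∀ (g : ℕ → ℕ) (b : ∀ n : ℕ, Fin (n - g n) → Ω n → EuclideanSpace ℝ (Fin n)),
      (∀ᶠ n in atTop, g n + 2 ≤ n) → Tendsto g atTop atTop →
      (∀ n, RandomBasis.IsRandomBasis (P n) (ν n) (b n)) →
      ∀ ε : ℝ, 0 < ε →
        Tendsto (fun n => P n {ω | ε ≤ |RandomBasis.reductionLevel (fun i => b n i ω) - 1|})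
          atTop (𝓝 0)) ∧
    (∀ k : ℕ,
      (∀ᵐ ω ∂P', ∃! j : ℕ,
        k + 1 ≤ j ∧ RandomBasis.limitRatio η j ω = RandomBasis.limitLevel η k ω) ∧
      ∀ b : ∀ n : ℕ, Fin (n - k) → Ω n → EuclideanSpace ℝ (Fin n),
        (∀ n, RandomBasis.IsRandomBasis (P n) (ν n) (b n)) →
        TendstoInDistribution (fun n ω => RandomBasis.worstIndex (fun i => b n i ω)) atTop
          (RandomBasis.limitIndex η k) P P') := by
  refine ⟨fun k b hb => RandomBasis.tendstoInDistribution_reductionLevel hν hconc hη hb,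
    fun g b hg hg' hb ε hε =>
      RandomBasis.tendsto_measure_reductionLevel_sub_one hν hconc hη hg hg' hb hε,
    fun k => ⟨?_, fun b hb => RandomBasis.tendstoInDistribution_worstIndex hν hconc hη hb⟩⟩
  filter_upwards [hη.ae_exists_gap k] with ω ⟨j, hj, hpos, κ, hκ, h⟩
  have hlt : ∀ i, k + 1 ≤ i → i ≠ j →
      RandomBasis.limitRatio η j ω < RandomBasis.limitRatio η i ω := fun i hi hij => by
    nlinarith [h i hi hij]
  exact ⟨j, ⟨hj, (RandomBasis.limitLevel_eq hj hlt).symm⟩, fun i hi =>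
    RandomBasis.eq_of_limitRatio_eq_limitLevel hj hlt i hi.1 hi.2⟩
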